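/- Let $n\ge 2$ and let $\kappa_0,\kappa,\kappa_n,\psi_0,\psi_n\in\mathbb{C}^*$; put $\kappa_i:=\kappa$ for $1\le i<n$. Let $\mathcal B$ be the affine braid group of type $\widetilde C_n$, with generators $\sigma_0,\dots,\sigma_n$ and relations $\sigma_0\sigma_1\sigma_0\sigma_1=\sigma_1\sigma_0\sigma_1\sigma_0$, $\sigma_{n-1}\sigma_n\sigma_{n-1}\sigma_n=\sigma_n\sigma_{n-1}\sigma_n\sigma_{n-1}$, $\sigma_i\sigma_{i+1}\sigma_i=\sigma_{i+1}\sigma_i\sigma_{i+1}$ for $1\le i<n-1$, and $\sigma_i\sigma_j=\sigma_j\sigma_i$ for $0\le i,j\le n$ with $|i-j|>1$. The affine Hecke algebra $H=H(\underline\kappa)$ is the quotient of $\mathbb{C}[\mathcal B]$ by the two-sided ideal generated by the elements $(\sigma_j-\kappa_j)(\sigma_j+\kappa_j^{-1})$, $0\le j\le n$. Let $T_j$ be the image of $\sigma_j$ in $H$, let $$Y_i:=T_{i-1}^{-1}\cdots T_1^{-1}\,T_0T_1\cdots T_{n-1}T_n\,T_{n-1}\cdots T_i\qquad(1\le i\le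 n),$$ and let $Y^\lambda:=Y_1^{\lambda_1}\cdots Y_n^{\lambda_n}$ for $\lambda\in\mathbb{Z}^n$. The spin representation $\rho_{\psi_0,\psi_n}$ is the representation of $H$ on $(\mathbb{C}^2)^{\otimes n}$ given by $T_0\mapsto\bar K_1$, $T_i\mapsto(\Upsilon\circ P)_{i,i+1}$ $(1\le i<n)$ and $T_n\mapsto K_n$, where the subscripts indicate the tensor legs on which an operator acts, $P(v\otimes w)=w\otimes v$, and, with respect to the ordered basis $(v_+,v_-)$ of $\mathbb{C}^2$ and the ordered basis $(v_+\otimes v_+,v_+\otimes v_-,v_-\otimes v_+,v_-\otimes v_-)$ of $\mathbb{C}^2\otimes\mathbb{C}^2$, $$\bar K=\begin{pmatrix}\kappa_0-\kappa_0^{-1}&\psi_0\\ \psi_0^{-1}&0\end{pmatrix},\quad K=\begin{pmatrix}0&\psi_n^{-1}\\ \psi_n&\kappa_n-\kappa_n^{-1}\end{pmatrix},\quad \Upsilon=\begin{pmatrix}\kappa&0&0&0\\0&1&0&0\\0&\kappa-\kappa^{-1}&1&0\\0&0&0&\kappa\end{pmatrix}.$$ For $I\subseteq\{1,\dots,n\}$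 let $H_I$ be the subalgebra of $H$ generated by the $T_i$ $(i\in I)$ and all $Y^\lambda$ $(\lambda\in\mathbb{Z}^n)$, and let $T_I$ be the set of those $\gamma\in(\mathbb{C}^*)^n$ with $\gamma_n=\kappa_0\kappa_n$ if $n\in I$ and $\gamma_i/\gamma_{i+1}=\kappa^2$ for all $i\in I$ with $i<n$. For $\gamma\in T_I$ let $\chi_{I,\gamma}:H_I\to\mathbb{C}$ be the algebra map with $T_i\mapsto\kappa_i$ $(i\in I)$ and $Y^\lambda\mapsto\gamma_1^{\lambda_1}\cdots\gamma_n^{\lambda_n}$ $(\lambda\in\mathbb{Z}^n)$, and let $M_I(\gamma):=H\otimes_{H_I}\mathbb{C}_{I,\gamma}$ be the principal series module, where $\mathbb{C}_{I,\gamma}$ is $\mathbb{C}$ with $H_I$ acting through $\chi_{I,\gamma}$. **Proposition.** Let $J:=\{1,\dots,n-1\}$ and $$\zeta:=(\psi_0\psi_n\kappa^{n-1},\psi_0\psi_n\kappa^{n-3},\dots,\psi_0\psi_n\kappa^{1-n}).$$ Then $\zeta\in T_J$, there is a unique algebra map $\chi_{J,\zeta}$ as above, and the spin representation $\rho_{\psi_0,\psi_n}$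 of $H$ on $(\mathbb{C}^2)^{\otimes n}$ is isomorphic to the principal series module $M_J(\zeta)$. -/

import Mathlib

open scoped TensorProduct

namespace SpinHecke

noncomputable section

/-! ### The affine braid group of type `C̃ₙ` -/

/-- The free generator `σ_k`, for a natural number `0 ≤ k ≤ n`
(only such values of `k` are ever used). -/
def freeGen (n k : ℕ) : FreeGroup (Fin (n + 1)) := FreeGroup.of (Fin.ofNat (n + 1) k)

/-- The braid relations of type `C̃ₙ`, for `n ≥ 2`, as relators. -/
inductive BraidRel (n : ℕ) : FreeGroup (Fin (n + 1)) → Prop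
  | left : BraidRel n
      ((freeGen n 0 * freeGen n 1 * freeGen n 0 * freeGen n 1) *
        (freeGen n 1 * freeGen n 0 * freeGen n 1 * freeGen n 0)⁻¹)
  | right : BraidRel n
      ((freeGen n (n - 1) * freeGen n n * freeGen n (n - 1) * freeGen n n) *
        (freeGen n n * freeGen n (n - 1) * freeGen n n * freeGen n (n - 1))⁻¹)
  | middle (i : ℕ) (h1 : 1 ≤ i) (h2 : i + 1 < n) : BraidRel n
      ((freeGen n i * freeGen n (i + 1) * freeGen n i) *
        (freeGen n (i + 1) * freeGen n i * freeGen n (i + 1))⁻¹)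
  | far (i j : ℕ) (h1 : i + 1 < j) (h2 : j ≤ n) : BraidRel n
      ((freeGen n i * freeGen n j) * (freeGen n j * freeGen n i)⁻¹)

/-- The affine braid group of type `C̃ₙ`. -/
abbrev BraidGroup (n : ℕ) : Type := PresentedGroup {r | BraidRel n r}

/-- The generator `σ_k` of the affine braid group, `0 ≤ k ≤ n`. -/
def sigma (n k : ℕ) : BraidGroup n := PresentedGroup.of (Fin.ofNat (n + 1) k)

/-- The element
`σ_{m-1}⁻¹ ⋯ σ_1⁻¹ · σ_0 σ_1 ⋯ σ_{n-1} σ_n · σ_{n-1} ⋯ σ_m` with `m = i + 1`, for `i : Fin n`. -/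
def braidG (n : ℕ) (i : Fin n) : BraidGroup n :=
  ((List.range i).reverse.map fun k => (sigma n (k + 1))⁻¹).prod *
  ((List.range (n + 1)).map fun k => sigma n k).prod *
  ((List.range' (i + 1) (n - 1 - i)).reverse.map fun k => sigma n k).prod

/-- The element `g_1^{λ_1} ⋯ g_n^{λ_n}` of the braid group. -/
def braidGPow (n : ℕ) (l : Fin n → ℤ) : BraidGroup n :=
  (List.ofFn fun i : Fin n => braidG n i ^ l i).prod

/-! ### The affine Hecke algebra -/

/-- The parameters `(κ_0, κ_1, …, κ_n)` with `κ_1 = ⋯ = κ_{n-1} = κ`. -/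
def heckeParam (n : ℕ) (κ₀ κ κₙ : ℂˣ) (j : Fin (n + 1)) : ℂˣ :=
  if (j : ℕ) = 0 then κ₀ else if (j : ℕ) = n then κₙ else κ

/-- The element of the group algebra `ℂ[B]` given by a braid. -/
def groupAlg (n : ℕ) : BraidGroup n →* MonoidAlgebra ℂ (BraidGroup n) :=
  MonoidAlgebra.of ℂ (BraidGroup n)

/-- The relations `(σ_j - κ_j)(σ_j + κ_j⁻¹) = 0` in the group algebra of the braid group. -/
inductive HeckeRel (n : ℕ) (κ₀ κ κₙ : ℂˣ) :
    MonoidAlgebra ℂ (BraidGroup n) → MonoidAlgebra ℂ (BraidGroup n) → Prop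
  | quad (j : Fin (n + 1)) : HeckeRel n κ₀ κ κₙ
      ((groupAlg n (sigma n j) - algebraMap ℂ _ (heckeParam n κ₀ κ κₙ j : ℂ)) *
        (groupAlg n (sigma n j) + algebraMap ℂ _ ((heckeParam n κ₀ κ κₙ j)⁻¹ : ℂˣ))) 0

/-- The affine Hecke algebra of type `C̃ₙ`: the quotient of `ℂ[B]` by the two-sided ideal
generated by the elements `(σ_j - κ_j)(σ_j + κ_j⁻¹)`. -/
abbrev Hecke (n : ℕ) (κ₀ κ κₙ : ℂˣ) : Type := RingQuot (HeckeRel n κ₀ κ κₙ)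

/-- The canonical map from braids to the affine Hecke algebra. -/
def braidToHecke (n : ℕ) (κ₀ κ κₙ : ℂˣ) : BraidGroup n →* Hecke n κ₀ κ κₙ :=
  (RingQuot.mkAlgHom ℂ (HeckeRel n κ₀ κ κₙ) :
    MonoidAlgebra ℂ (BraidGroup n) →* Hecke n κ₀ κ κₙ).comp (groupAlg n)

/-- The generators `T_0, …, T_n` of the affine Hecke algebra. -/
def T (n : ℕ) (κ₀ κ κₙ : ℂˣ) (j : Fin (n + 1)) : Hecke n κ₀ κ κₙ :=
  braidToHecke n κ₀ κ κₙ (sigma n j)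

/-- The elements `Y^λ = Y_1^{λ_1} ⋯ Y_n^{λ_n}` of the affine Hecke algebra. -/
def Y (n : ℕ) (κ₀ κ κₙ : ℂˣ) (l : Fin n → ℤ) : Hecke n κ₀ κ κₙ :=
  braidToHecke n κ₀ κ κₙ (braidGPow n l)

/-! ### Principal series modules

A subset `I ⊆ {1, …, n}` is encoded as a `Set (Fin n)`, with `i : Fin n` standing for `i + 1`,
which is the value of `i.succ : Fin (n + 1)`. -/

/-- The subalgebra `H_I` generated by the `T_i`, `i ∈ I`, and all `Y^λ`. -/
def heckeSub (n : ℕ) (κ₀ κ κₙ : ℂˣ) (I : Set (Fin n)) : Subalgebra ℂ (Hecke n κ₀ κ κₙ) :=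
  Algebra.adjoin ℂ ((fun i : Fin n => T n κ₀ κ κₙ i.succ) '' I ∪ Set.range (Y n κ₀ κ κₙ))

/-- The set `T_I` of those `γ ∈ (ℂ^*)^n` such that `γ_n = κ_0 κ_n` if `n ∈ I`, and
`γ_i / γ_{i+1} = κ²` if `i ∈ I`, `i < n`. -/
def torusSub (n : ℕ) (κ₀ κ κₙ : ℂˣ) (I : Set (Fin n)) : Set (Fin n → ℂˣ) :=
  {γ | (∀ i ∈ I, (i : ℕ) + 1 = n → γ i = κ₀ * κₙ) ∧
    ∀ i ∈ I, ∀ j : Fin n, (j : ℕ) = i + 1 → γ i / γ j = κ ^ 2}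

theorem T_mem_heckeSub {n : ℕ} (κ₀ κ κₙ : ℂˣ) {I : Set (Fin n)} {i : Fin n} (hi : i ∈ I) :
    T n κ₀ κ κₙ i.succ ∈ heckeSub n κ₀ κ κₙ I :=
  Algebra.subset_adjoin (Or.inl ⟨i, hi, rfl⟩)

theorem Y_mem_heckeSub {n : ℕ} (κ₀ κ κₙ : ℂˣ) (I : Set (Fin n)) (l : Fin n → ℤ) :
    Y n κ₀ κ κₙ l ∈ heckeSub n κ₀ κ κₙ I :=
  Algebra.subset_adjoin (Or.inr ⟨l, rfl⟩)

/-- `χ` is the character `χ_{I,γ}` of `H_I`: it sends `T_i` to `κ_i` for `i ∈ I` and `Y^λ` to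
`γ^λ = γ_1^{λ_1} ⋯ γ_n^{λ_n}`. -/
def IsPrincipalChar (n : ℕ) (κ₀ κ κₙ : ℂˣ) (I : Set (Fin n)) (γ : Fin n → ℂˣ)
    (χ : heckeSub n κ₀ κ κₙ I →ₐ[ℂ] ℂ) : Prop :=
  (∀ (i : Fin n) (hi : i ∈ I),
      χ ⟨T n κ₀ κ κₙ i.succ, T_mem_heckeSub κ₀ κ κₙ hi⟩ = (heckeParam n κ₀ κ κₙ i.succ : ℂ)) ∧
  (∀ l : Fin n → ℤ,
      χ ⟨Y n κ₀ κ κₙ l, Y_mem_heckeSub κ₀ κ κₙ I l⟩ = ((∏ i, γ i ^ l i : ℂˣ) : ℂ))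

section Induced

variable {A : Type*} [Ring A] [Algebra ℂ A]

/-- The `A`-submodule of `A ⊗_ℂ ℂ` generated by the elements `ab ⊗ z - a ⊗ χ(b) z`
with `a ∈ A`, `b ∈ B`, `z ∈ ℂ`. -/
def inducedRel (B : Subalgebra ℂ A) (χ : B →ₐ[ℂ] ℂ) : Submodule A (A ⊗[ℂ] ℂ) :=
  Submodule.span A {x | ∃ (a : A) (b : B) (z : ℂ), x = (a * b) ⊗ₜ[ℂ] z - a ⊗ₜ[ℂ] (χ b * z)}

/-- The induced module `A ⊗_B ℂ_χ`, where `ℂ_χ` is `ℂ` with `B` acting through the character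
`χ`: the quotient of `A ⊗_ℂ ℂ` that balances the right action of `B` on `A` with its left action
on `ℂ_χ`, with `A` acting by left multiplication on the first factor. -/
abbrev Induced (B : Subalgebra ℂ A) (χ : B →ₐ[ℂ] ℂ) : Type _ := (A ⊗[ℂ] ℂ) ⧸ inducedRel B χ

/-- The representation map of the induced module: `h · (h' ⊗ z) = (h h') ⊗ z`. -/
def inducedRep (B : Subalgebra ℂ A) (χ : B →ₐ[ℂ] ℂ) : A →ₐ[ℂ] Module.End ℂ (Induced B χ) :=
  Algebra.lsmul ℂ ℂ (Induced B χ)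

/-- Two representations of `A` are isomorphic if there is an invertible intertwiner. -/
def RepIso {V W : Type*} [AddCommMonoid V] [Module ℂ V] [AddCommMonoid W] [Module ℂ W]
    (ρ : A →ₐ[ℂ] Module.End ℂ V) (π : A →ₐ[ℂ] Module.End ℂ W) : Prop :=
  ∃ e : V ≃ₗ[ℂ] W, ∀ (h : A) (v : V), e (ρ h v) = π h (e v)

end Induced

/-- The representation map `π_{I,γ}` of the principal series module
`M_I(γ) = H ⊗_{H_I} ℂ_{I,γ}`, where `χ` is the character `χ_{I,γ}`. -/
def principalSeries (n : ℕ) (κ₀ κ κₙ : ℂˣ) (I : Set (Fin n))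
    (χ : heckeSub n κ₀ κ κₙ I →ₐ[ℂ] ℂ) :
    Hecke n κ₀ κ κₙ →ₐ[ℂ] Module.End ℂ (Induced (heckeSub n κ₀ κ κₙ I) χ) :=
  inducedRep (heckeSub n κ₀ κ κₙ I) χ

/-! ### Operators on `(ℂ²)^{⊗ n}` in tensor leg notation -/

/-- The space `(ℂ²)^{⊗ n}`. The ordered basis `(v_+, v_-)` of `ℂ²` is the standard basis
of `Fin 2 → ℂ`. -/
abbrev SpinSpace (n : ℕ) : Type := ⨂[ℂ] (_ : Fin n), (Fin 2 → ℂ)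

/-- The operator `A_i`: the `2 × 2` matrix `A` acting on the `i`-th tensor leg. -/
def leg {n : ℕ} (i : Fin n) (A : Matrix (Fin 2) (Fin 2) ℂ) : Module.End ℂ (SpinSpace n) :=
  PiTensorProduct.map (Function.update (fun _ => LinearMap.id) i (Matrix.toLin' A))

/-- The operator `M_{i,j}`, for `M` a matrix with respect to the basis
`v_a ⊗ v_b` of `ℂ² ⊗ ℂ²`: since `M` is the sum of the `M_{(a,b),(c,d)} E_{ac} ⊗ E_{bd}`,
it acts on the legs `i ≠ j` as the sum of the `M_{(a,b),(c,d)} (E_{ac})_i (E_{bd})_j`. -/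
def leg2 {n : ℕ} (i j : Fin n) (M : Matrix (Fin 2 × Fin 2) (Fin 2 × Fin 2) ℂ) :
    Module.End ℂ (SpinSpace n) :=
  ∑ a : Fin 2, ∑ b : Fin 2, ∑ c : Fin 2, ∑ d : Fin 2,
    M (a, b) (c, d) • (leg i (Matrix.single a c 1) * leg j (Matrix.single b d 1))

/-- A `4 × 4` matrix with respect to the ordered basis
`(v_+ ⊗ v_+, v_+ ⊗ v_-, v_- ⊗ v_+, v_- ⊗ v_-)`, reindexed by pairs. -/
def toPairs (M : Matrix (Fin 4) (Fin 4) ℂ) : Matrix (Fin 2 × Fin 2) (Fin 2 × Fin 2) ℂ :=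
  Matrix.of fun p q => M (finProdFinEquiv p) (finProdFinEquiv q)

/-- The matrix `K̄`. -/
def KBar (κ₀ ψ₀ : ℂˣ) : Matrix (Fin 2) (Fin 2) ℂ :=
  !![(κ₀ : ℂ) - (κ₀ : ℂ)⁻¹, (ψ₀ : ℂ); (ψ₀ : ℂ)⁻¹, 0]

/-- The matrix `K`. -/
def KMat (κₙ ψₙ : ℂˣ) : Matrix (Fin 2) (Fin 2) ℂ :=
  !![0, (ψₙ : ℂ)⁻¹; (ψₙ : ℂ), (κₙ : ℂ) - (κₙ : ℂ)⁻¹]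

/-- The matrix `Υ`. -/
def Upsilon (κ : ℂˣ) : Matrix (Fin 2 × Fin 2) (Fin 2 × Fin 2) ℂ :=
  toPairs !![(κ : ℂ), 0, 0, 0; 0, 1, 0, 0; 0, (κ : ℂ) - (κ : ℂ)⁻¹, 1, 0; 0, 0, 0, (κ : ℂ)]

/-- The matrix of the flip operator `P (v ⊗ w) = w ⊗ v`. -/
def flipMat : Matrix (Fin 2 × Fin 2) (Fin 2 × Fin 2) ℂ :=
  Matrix.of fun p q => if p = q.swap then 1 else 0

/-- The operators by which `T_0, …, T_n` act in the spin representation: `K̄_1` for `j = 0`,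
`K_n` for `j = n`, and `(Υ ∘ P)_{j,j+1}` for `1 ≤ j < n` (the legs are numbered from `0`
in `Fin n`). -/
def spinGen (n : ℕ) (hn : 2 ≤ n) (κ₀ κ κₙ ψ₀ ψₙ : ℂˣ) (j : Fin (n + 1)) :
    Module.End ℂ (SpinSpace n) :=
  if h0 : (j : ℕ) = 0 then leg ⟨0, by omega⟩ (KBar κ₀ ψ₀)
  else if hl : (j : ℕ) = n then leg ⟨n - 1, by omega⟩ (KMat κₙ ψₙ)
  else leg2 ⟨j - 1, by omega⟩ ⟨j, by omega⟩ (Upsilon κ * flipMat)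

/-! ### The defining relations of the spin representation -/

/-- The pure tensor `v_{ε_1} ⊗ ⋯ ⊗ v_{ε_n}`. -/
def spinVec {n : ℕ} (ε : Fin n → Fin 2) : SpinSpace n :=
  PiTensorProduct.tprod ℂ fun k => Pi.single (ε k) (1 : ℂ)

theorem end_ext {n : ℕ} {f g : Module.End ℂ (SpinSpace n)}
    (h : ∀ ε : Fin n → Fin 2, f (spinVec ε) = g (spinVec ε)) : f = g := by
  apply PiTensorProduct.ext
  apply Module.Basis.ext_multilinear (fun _ : Fin n => Pi.basisFun ℂ (Fin 2))
  intro v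
  simpa [spinVec] using h v

theorem leg_spinVec {n : ℕ} (i : Fin n) (A : Matrix (Fin 2) (Fin 2) ℂ) (ε : Fin n → Fin 2) :
    leg i A (spinVec ε) = ∑ a, A a (ε i) • spinVec (Function.update ε i a) := by
  unfold leg spinVec
  rw [PiTensorProduct.map_tprod]
  have h1 : (fun k => (Function.update (fun _ : Fin n => LinearMap.id) i (Matrix.toLin' A)
      : Fin n → (Fin 2 → ℂ) →ₗ[ℂ] (Fin 2 → ℂ)) k (Pi.single (ε k) 1)) =
      Function.update (fun k => (Pi.single (ε k) 1 : Fin 2 → ℂ)) i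
        (∑ a, A a (ε i) • (Pi.single a 1 : Fin 2 → ℂ)) := by
    funext k
    by_cases hk : k = i
    · subst hk
      simp only [Function.update_self]
      ext a
      simp [Pi.single_apply]
    · simp [hk]
  rw [h1, MultilinearMap.map_update_sum]
  refine Finset.sum_congr rfl fun a _ => ?_
  rw [MultilinearMap.map_update_smul]
  congr 2
  funext k
  by_cases hk : k = i
  · subst hk; simp
  · simp [hk]

theorem leg2_spinVec {n : ℕ} {i j : Fin n} (hij : i ≠ j)
    (M : Matrix (Fin 2 × Fin 2) (Fin 2 × Fin 2) ℂ) (ε : Fin n → Fin 2) :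
    leg2 i j M (spinVec ε) = ∑ a, ∑ b, M (a, b) (ε i, ε j) •
      spinVec (Function.update (Function.update ε i a) j b) := by
  have key : ∀ a b c d : Fin 2, (leg i (Matrix.single a c 1) * leg j (Matrix.single b d 1))
      (spinVec ε) = if c = ε i ∧ d = ε j then
        spinVec (Function.update (Function.update ε i a) j b) else 0 := by
    intro a b c d
    rw [Module.End.mul_apply, leg_spinVec, map_sum]
    simp only [map_smul, leg_spinVec, Function.update_of_ne hij, Matrix.single_apply]
    by_cases hc : c = ε i <;> by_cases hd : d = ε j <;> simp [hc, hd]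
    rw [Function.update_comm hij.symm]
  simp only [leg2, LinearMap.sum_apply, LinearMap.smul_apply, key]
  refine Finset.sum_congr rfl fun a _ => Finset.sum_congr rfl fun b _ => ?_
  rw [Finset.sum_eq_single (ε i), Finset.sum_eq_single (ε j)]
  · simp
  · intro x _ hx; simp [hx]
  · simp
  · intro x _ hx; simp [hx]
  · simp

theorem leg_commute {n : ℕ} {i j : Fin n} (hij : i ≠ j) (A B : Matrix (Fin 2) (Fin 2) ℂ) :
    Commute (leg i A) (leg j B) := by
  apply end_ext
  intro ε
  simp only [Module.End.mul_apply, leg_spinVec, map_sum, map_smul,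
    Function.update_of_ne hij, Function.update_of_ne hij.symm]
  simp only [Finset.smul_sum]
  rw [Finset.sum_comm]
  refine Finset.sum_congr rfl fun a _ => Finset.sum_congr rfl fun b _ => ?_
  rw [smul_comm, Function.update_comm hij.symm]

theorem leg_commute_leg2 {n : ℕ} {i j k : Fin n} (hj : i ≠ j) (hk : i ≠ k)
    (A : Matrix (Fin 2) (Fin 2) ℂ) (M : Matrix (Fin 2 × Fin 2) (Fin 2 × Fin 2) ℂ) :
    Commute (leg i A) (leg2 j k M) := by
  unfold leg2
  refine Commute.sum_right _ _ _ fun a _ => Commute.sum_right _ _ _ fun b _ =>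
    Commute.sum_right _ _ _ fun c _ => Commute.sum_right _ _ _ fun d _ => ?_
  exact ((leg_commute hj _ _).mul_right (leg_commute hk _ _)).smul_right _

theorem leg2_commute {n : ℕ} {i j k l : Fin n} (h1 : i ≠ k) (h2 : i ≠ l) (h3 : j ≠ k)
    (h4 : j ≠ l) (M N : Matrix (Fin 2 × Fin 2) (Fin 2 × Fin 2) ℂ) :
    Commute (leg2 i j M) (leg2 k l N) := by
  rw [leg2]
  refine Commute.sum_left _ _ _ fun a _ => Commute.sum_left _ _ _ fun b _ =>
    Commute.sum_left _ _ _ fun c _ => Commute.sum_left _ _ _ fun d _ => ?_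
  exact ((leg_commute_leg2 h1 h2 _ _).mul_left (leg_commute_leg2 h3 h4 _ _)).smul_left _

/-- `T_i` on two neighbouring legs. -/
theorem upsilon_flip (κ : ℂˣ) (a b c d : Fin 2) :
    (Upsilon κ * flipMat) (a, b) (c, d) =
      (if a = d ∧ b = c then (if a = b then (κ : ℂ) else 1) else 0) +
      (if a = 1 ∧ b = 0 ∧ c = 1 ∧ d = 0 then (κ : ℂ) - (κ : ℂ)⁻¹ else 0) := by
  rw [Matrix.mul_apply, Finset.sum_eq_single (d, c)]
  · fin_cases a <;> fin_cases b <;> fin_cases c <;> fin_cases d <;>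
      simp [Upsilon, toPairs, flipMat, finProdFinEquiv]
  · rintro ⟨x, y⟩ _ h
    have h0 : flipMat (x, y) (c, d) = 0 := by
      simp only [flipMat, Matrix.of_apply]
      exact if_neg h
    rw [h0, mul_zero]
  · simp

theorem spinVec_two {n : ℕ} {i j : Fin n} (ε : Fin n → Fin 2) :
    spinVec ε = spinVec (Function.update (Function.update ε i (ε i)) j (ε j)) := by simp

theorem quad_leg {n : ℕ} (i : Fin n) (A : Matrix (Fin 2) (Fin 2) ℂ) (k : ℂˣ)
    (hd : A.det = -1) (ht : A.trace = k - (k : ℂ)⁻¹) :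
    leg i A * leg i A = ((k : ℂ) - (k : ℂ)⁻¹) • leg i A + 1 := by
  apply end_ext
  intro ε
  simp only [Module.End.mul_apply, leg_spinVec, map_sum, map_smul, LinearMap.add_apply,
    LinearMap.smul_apply, Module.End.one_apply, Function.update_self, Function.update_idem]
  rw [← ht]
  rw [Matrix.det_fin_two] at hd
  rw [Matrix.trace_fin_two]
  simp only [Fin.sum_univ_two]
  have h : spinVec ε = spinVec (Function.update ε i (ε i)) := by simp
  rw [h]
  generalize ε i = x
  fin_cases x
  · simp only [Fin.mk_zero]
    match_scalars
    · linear_combination -hd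
    · ring
  · simp only [Fin.mk_one]
    match_scalars
    · ring
    · linear_combination -hd

theorem quad_leg2 {n : ℕ} {i j : Fin n} (hij : i ≠ j) (κ : ℂˣ) :
    leg2 i j (Upsilon κ * flipMat) * leg2 i j (Upsilon κ * flipMat) =
      ((κ : ℂ) - (κ : ℂ)⁻¹) • leg2 i j (Upsilon κ * flipMat) + 1 := by
  have hκ : (κ : ℂ) ≠ 0 := κ.ne_zero
  apply end_ext
  intro ε
  set F : Fin 2 → Fin 2 → SpinSpace n := fun x y =>
    spinVec (Function.update (Function.update ε i x) j y) with hF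
  have hT : ∀ x y, leg2 i j (Upsilon κ * flipMat) (F x y) =
      ∑ a, ∑ b, (Upsilon κ * flipMat) (a, b) (x, y) • F a b := by
    intro x y
    simp only [hF]
    rw [leg2_spinVec hij]
    simp [Function.update_of_ne hij, Function.update_comm hij]
  have h : spinVec ε = F (ε i) (ε j) := spinVec_two ε
  rw [h]
  generalize ε i = x
  generalize ε j = y
  simp only [Module.End.mul_apply, LinearMap.add_apply, LinearMap.smul_apply,
    Module.End.one_apply]
  fin_cases x <;> fin_cases y <;>
    simp [hT, Fin.sum_univ_two, upsilon_flip] <;> match_scalars <;> field_simp <;> ring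

theorem braid_left {n : ℕ} {i j : Fin n} (hij : i ≠ j) (κ₀ κ ψ₀ : ℂˣ) :
    leg i (KBar κ₀ ψ₀) * leg2 i j (Upsilon κ * flipMat) *
      leg i (KBar κ₀ ψ₀) * leg2 i j (Upsilon κ * flipMat) =
    leg2 i j (Upsilon κ * flipMat) * leg i (KBar κ₀ ψ₀) *
      leg2 i j (Upsilon κ * flipMat) * leg i (KBar κ₀ ψ₀) := by
  have hκ : (κ : ℂ) ≠ 0 := κ.ne_zero
  have hκ0 : (κ₀ : ℂ) ≠ 0 := κ₀.ne_zero
  have hψ : (ψ₀ : ℂ) ≠ 0 := ψ₀.ne_zero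
  apply end_ext
  intro ε
  set F : Fin 2 → Fin 2 → SpinSpace n := fun x y =>
    spinVec (Function.update (Function.update ε i x) j y) with hF
  have hT : ∀ x y, leg2 i j (Upsilon κ * flipMat) (F x y) =
      ∑ a, ∑ b, (Upsilon κ * flipMat) (a, b) (x, y) • F a b := by
    intro x y
    simp only [hF]
    rw [leg2_spinVec hij]
    simp [Function.update_of_ne hij, Function.update_comm hij]
  have hK : ∀ x y, leg i (KBar κ₀ ψ₀) (F x y) = ∑ a, KBar κ₀ ψ₀ a x • F a y := by
    intro x y
    simp only [hF]
    rw [leg_spinVec]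
    simp [Function.update_of_ne hij, Function.update_comm hij]
  have h : spinVec ε = F (ε i) (ε j) := spinVec_two ε
  rw [h]
  generalize ε i = x
  generalize ε j = y
  simp only [Module.End.mul_apply]
  fin_cases x <;> fin_cases y <;>
    simp only [hT, hK, Fin.sum_univ_two, map_add, map_smul, upsilon_flip] <;>
    simp [KBar] <;> match_scalars <;> field_simp <;> ring

theorem braid_right {n : ℕ} {i j : Fin n} (hij : i ≠ j) (κₙ κ ψₙ : ℂˣ) :
    leg2 i j (Upsilon κ * flipMat) * leg j (KMat κₙ ψₙ) *
      leg2 i j (Upsilon κ * flipMat) * leg j (KMat κₙ ψₙ) =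
    leg j (KMat κₙ ψₙ) * leg2 i j (Upsilon κ * flipMat) *
      leg j (KMat κₙ ψₙ) * leg2 i j (Upsilon κ * flipMat) := by
  have hκ : (κ : ℂ) ≠ 0 := κ.ne_zero
  have hκn : (κₙ : ℂ) ≠ 0 := κₙ.ne_zero
  have hψ : (ψₙ : ℂ) ≠ 0 := ψₙ.ne_zero
  apply end_ext
  intro ε
  set F : Fin 2 → Fin 2 → SpinSpace n := fun x y =>
    spinVec (Function.update (Function.update ε i x) j y) with hF
  have hT : ∀ x y, leg2 i j (Upsilon κ * flipMat) (F x y) =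
      ∑ a, ∑ b, (Upsilon κ * flipMat) (a, b) (x, y) • F a b := by
    intro x y
    simp only [hF]
    rw [leg2_spinVec hij]
    simp [Function.update_of_ne hij, Function.update_comm hij]
  have hK : ∀ x y, leg j (KMat κₙ ψₙ) (F x y) = ∑ a, KMat κₙ ψₙ a y • F x a := by
    intro x y
    simp only [hF]
    rw [leg_spinVec]
    simp
  have h : spinVec ε = F (ε i) (ε j) := spinVec_two ε
  rw [h]
  generalize ε i = x
  generalize ε j = y
  simp only [Module.End.mul_apply]
  fin_cases x <;> fin_cases y <;>
    simp only [hT, hK, Fin.sum_univ_two, map_add, map_smul, upsilon_flip] <;>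
    simp [KMat] <;> match_scalars <;> field_simp <;> ring

theorem braid_middle {n : ℕ} {i j k : Fin n} (hij : i ≠ j) (hik : i ≠ k) (hjk : j ≠ k)
    (κ : ℂˣ) :
    leg2 i j (Upsilon κ * flipMat) * leg2 j k (Upsilon κ * flipMat) *
      leg2 i j (Upsilon κ * flipMat) =
    leg2 j k (Upsilon κ * flipMat) * leg2 i j (Upsilon κ * flipMat) *
      leg2 j k (Upsilon κ * flipMat) := by
  have hκ : (κ : ℂ) ≠ 0 := κ.ne_zero
  apply end_ext
  intro ε
  set F : Fin 2 → Fin 2 → Fin 2 → SpinSpace n := fun x y z =>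
    spinVec (Function.update (Function.update (Function.update ε i x) j y) k z) with hF
  have h1 : ∀ x y z, leg2 i j (Upsilon κ * flipMat) (F x y z) =
      ∑ a, ∑ b, (Upsilon κ * flipMat) (a, b) (x, y) • F a b z := by
    intro x y z
    simp only [hF]
    rw [leg2_spinVec hij]
    simp [Function.update_of_ne hij.symm, Function.update_of_ne hik, Function.update_of_ne hjk,
      Function.update_comm hij, Function.update_comm hik, Function.update_comm hjk]
  have h2 : ∀ x y z, leg2 j k (Upsilon κ * flipMat) (F x y z) =
      ∑ a, ∑ b, (Upsilon κ * flipMat) (a, b) (y, z) • F x a b := by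
    intro x y z
    simp only [hF]
    rw [leg2_spinVec hjk]
    simp [Function.update_of_ne hjk, Function.update_comm hjk]
  have h : spinVec ε = F (ε i) (ε j) (ε k) := by simp [hF]
  rw [h]
  generalize ε i = x
  generalize ε j = y
  generalize ε k = z
  simp only [Module.End.mul_apply]
  fin_cases x <;> fin_cases y <;> fin_cases z <;>
    simp [h1, h2, Fin.sum_univ_two, upsilon_flip] <;> match_scalars <;> field_simp <;> ring

theorem quad_spinGen (n : ℕ) (hn : 2 ≤ n) (κ₀ κ κₙ ψ₀ ψₙ : ℂˣ) (j : Fin (n + 1)) :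
    spinGen n hn κ₀ κ κₙ ψ₀ ψₙ j * spinGen n hn κ₀ κ κₙ ψ₀ ψₙ j =
      ((heckeParam n κ₀ κ κₙ j : ℂ) - (heckeParam n κ₀ κ κₙ j : ℂ)⁻¹) •
        spinGen n hn κ₀ κ κₙ ψ₀ ψₙ j + 1 := by
  by_cases h0 : (j : ℕ) = 0
  · simp only [spinGen, heckeParam, h0, if_true, dif_pos]
    apply quad_leg
    · simp [KBar, Matrix.det_fin_two]
    · simp [KBar, Matrix.trace_fin_two]
  by_cases hl : (j : ℕ) = n
  · simp only [spinGen, heckeParam, hl, if_true, dif_pos]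
    rw [if_neg (by omega), dif_neg (by omega)]
    apply quad_leg
    · simp [KMat, Matrix.det_fin_two]
    · simp [KMat, Matrix.trace_fin_two]
  · simp only [spinGen, heckeParam, h0, hl, if_false, dif_neg, not_false_eq_true]
    apply quad_leg2
    intro h
    have := congrArg Fin.val h
    simp only at this
    omega

theorem mul_quad_inv {R : Type*} [Semiring R] [Algebra ℂ R] (x : R) (c : ℂ)
    (h : x * x = c • x + 1) : x * (x + (-c) • 1) = 1 ∧ (x + (-c) • 1) * x = 1 := by
  rw [mul_add, add_mul, h, mul_smul_comm, smul_mul_assoc, mul_one, one_mul,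
    add_right_comm, ← add_smul, add_neg_cancel, zero_smul, zero_add]
  exact ⟨rfl, rfl⟩

theorem quad_factor {R S : Type*} [Semiring R] [Algebra ℂ R] [Ring S] [Algebra ℂ S]
    (f : S →ₐ[ℂ] R) (g : S) (k : ℂˣ)
    (h : f g * f g = ((k : ℂ) - (k : ℂ)⁻¹) • f g + 1) :
    f ((g - algebraMap ℂ S (k : ℂ)) * (g + algebraMap ℂ S ((k⁻¹ : ℂˣ) : ℂ))) = f 0 := by
  have hp : (k : ℂ) ≠ 0 := k.ne_zero
  have e : (g - algebraMap ℂ S (k : ℂ)) * (g + algebraMap ℂ S ((k⁻¹ : ℂˣ) : ℂ)) =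
      g * g + ((-((k : ℂ) - (k : ℂ)⁻¹)) • g + (-1 : ℂ) • 1) := by
    simp only [Algebra.algebraMap_eq_smul_one, Units.val_inv_eq_inv_val, sub_mul, mul_add,
      mul_smul_comm, smul_mul_assoc, mul_one, one_mul]
    match_scalars <;> field_simp
    ring
  rw [e]
  simp only [map_add, map_mul, map_smul, map_one, map_zero, h]
  match_scalars <;> ring

/-- The operator of `T_j` in the spin representation, as an invertible operator. -/
def spinUnit (n : ℕ) (hn : 2 ≤ n) (κ₀ κ κₙ ψ₀ ψₙ : ℂˣ) (j : Fin (n + 1)) :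
    (Module.End ℂ (SpinSpace n))ˣ where
  val := spinGen n hn κ₀ κ κₙ ψ₀ ψₙ j
  inv := spinGen n hn κ₀ κ κₙ ψ₀ ψₙ j +
    (-((heckeParam n κ₀ κ κₙ j : ℂ) - (heckeParam n κ₀ κ κₙ j : ℂ)⁻¹)) • 1
  val_inv := (mul_quad_inv _ _ (quad_spinGen n hn κ₀ κ κₙ ψ₀ ψₙ j)).1
  inv_val := (mul_quad_inv _ _ (quad_spinGen n hn κ₀ κ κₙ ψ₀ ψₙ j)).2

theorem spinGen_zero (n : ℕ) (hn : 2 ≤ n) (κ₀ κ κₙ ψ₀ ψₙ : ℂˣ) :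
    spinGen n hn κ₀ κ κₙ ψ₀ ψₙ (Fin.ofNat (n + 1) 0) = leg ⟨0, by omega⟩ (KBar κ₀ ψ₀) := by
  simp [spinGen]

theorem spinGen_last (n : ℕ) (hn : 2 ≤ n) (κ₀ κ κₙ ψ₀ ψₙ : ℂˣ) :
    spinGen n hn κ₀ κ κₙ ψ₀ ψₙ (Fin.ofNat (n + 1) n) =
      leg ⟨n - 1, by omega⟩ (KMat κₙ ψₙ) := by
  have h : ((Fin.ofNat (n + 1) n : Fin (n + 1)) : ℕ) = n := Nat.mod_eq_of_lt (by omega)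
  rw [spinGen, dif_neg (by omega), dif_pos h]

theorem spinGen_mid (n : ℕ) (hn : 2 ≤ n) (κ₀ κ κₙ ψ₀ ψₙ : ℂˣ) (i : ℕ) (h1 : 1 ≤ i)
    (h2 : i < n) :
    spinGen n hn κ₀ κ κₙ ψ₀ ψₙ (Fin.ofNat (n + 1) i) =
      leg2 ⟨i - 1, by omega⟩ ⟨i, h2⟩ (Upsilon κ * flipMat) := by
  have h : ((Fin.ofNat (n + 1) i : Fin (n + 1)) : ℕ) = i := Nat.mod_eq_of_lt (by omega)
  rw [spinGen, dif_neg (by omega), dif_neg (by omega)]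
  simp only [h]

theorem spin_braidRel (n : ℕ) (hn : 2 ≤ n) (κ₀ κ κₙ ψ₀ ψₙ : ℂˣ) :
    ∀ r ∈ {r | BraidRel n r}, FreeGroup.lift (spinUnit n hn κ₀ κ κₙ ψ₀ ψₙ) r = 1 := by
  rintro r (hr : BraidRel n r)
  induction hr with
  | left =>
    rw [map_mul, map_inv, mul_inv_eq_one]
    simp only [freeGen, map_mul, FreeGroup.lift_apply_of]
    apply Units.ext
    simp only [Units.val_mul, spinUnit, spinGen_zero, spinGen_mid n hn _ _ _ _ _ 1 le_rfl hn]
    exact braid_left (by simp) _ _ _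
  | right =>
    rw [map_mul, map_inv, mul_inv_eq_one]
    simp only [freeGen, map_mul, FreeGroup.lift_apply_of]
    apply Units.ext
    simp only [Units.val_mul, spinUnit, spinGen_last,
      spinGen_mid n hn _ _ _ _ _ (n - 1) (by omega) (by omega)]
    exact braid_right (by simp only [ne_eq, Fin.mk.injEq]; omega) _ _ _
  | middle i h1 h2 =>
    rw [map_mul, map_inv, mul_inv_eq_one]
    simp only [freeGen, map_mul, FreeGroup.lift_apply_of]
    apply Units.ext
    simp only [Units.val_mul, spinUnit,
      spinGen_mid n hn _ _ _ _ _ i (by omega) (by omega),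
      spinGen_mid n hn _ _ _ _ _ (i + 1) (by omega) (by omega)]
    exact braid_middle (by simp only [ne_eq, Fin.mk.injEq]; omega)
      (by simp only [ne_eq, Fin.mk.injEq]; omega) (by simp) _
  | far i j h1 h2 =>
    rw [map_mul, map_inv, mul_inv_eq_one]
    simp only [freeGen, map_mul, FreeGroup.lift_apply_of]
    apply Units.ext
    simp only [Units.val_mul, spinUnit]
    change Commute _ _
    rcases Nat.eq_zero_or_pos i with rfl | hi
    · rw [spinGen_zero]
      rcases Nat.lt_or_eq_of_le h2 with hj | rfl
      · rw [spinGen_mid n hn _ _ _ _ _ j (by omega) hj]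
        exact leg_commute_leg2 (by simp only [ne_eq, Fin.mk.injEq]; omega)
          (by simp only [ne_eq, Fin.mk.injEq]; omega) _ _
      · rw [spinGen_last]
        exact leg_commute (by simp only [ne_eq, Fin.mk.injEq]; omega) _ _
    · rw [spinGen_mid n hn _ _ _ _ _ i hi (by omega)]
      rcases Nat.lt_or_eq_of_le h2 with hj | rfl
      · rw [spinGen_mid n hn _ _ _ _ _ j (by omega) hj]
        exact leg2_commute (by simp only [ne_eq, Fin.mk.injEq]; omega)
          (by simp only [ne_eq, Fin.mk.injEq]; omega)
          (by simp only [ne_eq, Fin.mk.injEq]; omega)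
          (by simp only [ne_eq, Fin.mk.injEq]; omega) _ _
      · rw [spinGen_last]
        exact (leg_commute_leg2 (by simp only [ne_eq, Fin.mk.injEq]; omega)
          (by simp only [ne_eq, Fin.mk.injEq]; omega) _ _).symm

/-- The action of the affine braid group on `(ℂ²)^{⊗ n}` underlying the spin representation. -/
def spinBraid (n : ℕ) (hn : 2 ≤ n) (κ₀ κ κₙ ψ₀ ψₙ : ℂˣ) :
    BraidGroup n →* Module.End ℂ (SpinSpace n) :=
  (Units.coeHom _).comp (PresentedGroup.toGroup (spin_braidRel n hn κ₀ κ κₙ ψ₀ ψₙ))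

theorem spinBraid_sigma (n : ℕ) (hn : 2 ≤ n) (κ₀ κ κₙ ψ₀ ψₙ : ℂˣ) (j : Fin (n + 1)) :
    spinBraid n hn κ₀ κ κₙ ψ₀ ψₙ (sigma n j) = spinGen n hn κ₀ κ κₙ ψ₀ ψₙ j := by
  have hj : Fin.ofNat (n + 1) (j : ℕ) = j := by simp
  simp only [spinBraid, sigma, hj, MonoidHom.comp_apply, PresentedGroup.toGroup.of]
  rfl

/-- The spin representation `ρ_{ψ_0,ψ_n}` of the affine Hecke algebra on `(ℂ²)^{⊗ n}`: the
algebra homomorphism with `T_0 ↦ K̄_1`, `T_i ↦ (Υ ∘ P)_{i,i+1}` for `1 ≤ i < n`, and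
`T_n ↦ K_n`. -/
def spinRep (n : ℕ) (hn : 2 ≤ n) (κ₀ κ κₙ ψ₀ ψₙ : ℂˣ) :
    Hecke n κ₀ κ κₙ →ₐ[ℂ] Module.End ℂ (SpinSpace n) :=
  RingQuot.liftAlgHom ℂ
    ⟨MonoidAlgebra.lift ℂ _ _ (spinBraid n hn κ₀ κ κₙ ψ₀ ψₙ), by
      rintro _ _ ⟨j⟩
      refine quad_factor _ _ _ ?_
      rw [groupAlg, MonoidAlgebra.lift_of, spinBraid_sigma]
      exact quad_spinGen n hn κ₀ κ κₙ ψ₀ ψₙ j⟩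

theorem spinRep_T (n : ℕ) (hn : 2 ≤ n) (κ₀ κ κₙ ψ₀ ψₙ : ℂˣ) (j : Fin (n + 1)) :
    spinRep n hn κ₀ κ κₙ ψ₀ ψₙ (T n κ₀ κ κₙ j) = spinGen n hn κ₀ κ κₙ ψ₀ ψₙ j := by
  simp only [spinRep, T, braidToHecke, groupAlg, MonoidHom.comp_apply, MonoidHom.coe_coe,
    RingQuot.liftAlgHom_mkAlgHom_apply, MonoidAlgebra.lift_of, spinBraid_sigma]

/-! ### The data of the statement -/

/-- The subset `J = {1, …, n-1}` of `{1, …, n}`. -/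
def setJ (n : ℕ) : Set (Fin n) := {i | (i : ℕ) + 1 < n}

/-- `ζ = (ψ_0 ψ_n κ^{n-1}, ψ_0 ψ_n κ^{n-3}, …, ψ_0 ψ_n κ^{1-n})`. -/
def zeta (n : ℕ) (κ ψ₀ ψₙ : ℂˣ) (i : Fin n) : ℂˣ :=
  ψ₀ * ψₙ * κ ^ ((n : ℤ) - 1 - 2 * (i : ℕ))

end

end SpinHecke

/-!
The vector `v₊ ⊗ ⋯ ⊗ v₊` is a common eigenvector of `H_J` in the spin representation, with
character `χ_{J,ζ}`, so Frobenius reciprocity yields an intertwiner from `M_J(ζ)` to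
`(ℂ²)^{⊗ n}` with `1 ⊗ 1 ↦ v₊ ⊗ ⋯ ⊗ v₊`. Put `A_p = T_p T_{p+1} ⋯ T_n`. On `(ℂ²)^{⊗ n}` the
operator `A_p` turns the `p`-th leg from `v₊` into `v₋` (up to a scalar) as long as the legs
`p, …, n` are all `v₊`; hence the vectors `A_{p_k} ⋯ A_{p_1} (v₊ ⊗ ⋯ ⊗ v₊)` with
`1 ≤ p_1 < ⋯ < p_k ≤ n` span, and the intertwiner is onto. The braid relations show that the
span of the `2^n` vectors `A_{p_k} ⋯ A_{p_1} (1 ⊗ 1)` in `M_J(ζ)` is stable under every `T_j`, so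
`dim M_J(ζ) ≤ 2^n` and the intertwiner is bijective.
-/

namespace SpinHecke

noncomputable section

/-! ### Products of the generators of the braid group -/

theorem mk_freeGen (n k : ℕ) :
    PresentedGroup.mk {r | BraidRel n r} (freeGen n k) = sigma n k := rfl

theorem mk_eq_mk_of_braidRel {n : ℕ} {x y : FreeGroup (Fin (n + 1))} (h : BraidRel n (x * y⁻¹)) :
    PresentedGroup.mk {r | BraidRel n r} x = PresentedGroup.mk {r | BraidRel n r} y :=
  PresentedGroup.mk_eq_mk_of_mul_inv_mem (rels := {r | BraidRel n r}) h

theorem sigma_braid_last (n : ℕ) :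
    sigma n (n - 1) * sigma n n * sigma n (n - 1) * sigma n n =
      sigma n n * sigma n (n - 1) * sigma n n * sigma n (n - 1) := by
  simpa only [map_mul, mk_freeGen] using mk_eq_mk_of_braidRel (BraidRel.right (n := n))

theorem sigma_braid {n i : ℕ} (h1 : 1 ≤ i) (hi : i + 1 < n) :
    sigma n i * sigma n (i + 1) * sigma n i = sigma n (i + 1) * sigma n i * sigma n (i + 1) := by
  simpa only [map_mul, mk_freeGen] using mk_eq_mk_of_braidRel (BraidRel.middle i h1 hi)

theorem commute_sigma {n i j : ℕ} (hij : i + 1 < j) (hj : j ≤ n) :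
    Commute (sigma n i) (sigma n j) := by
  rw [commute_iff_eq]
  simpa only [map_mul, mk_freeGen] using mk_eq_mk_of_braidRel (BraidRel.far i j hij hj)

/-- The braid `σ_p σ_{p+1} ⋯ σ_n`, equal to `1` for `p > n`. These are the elements `A_p` out of
which a spanning set of the principal series module is built. -/
def tailProd (n p : ℕ) : BraidGroup n := ((List.range' p (n + 1 - p)).map (sigma n)).prod

theorem tailProd_of_lt {n p : ℕ} (hp : n < p) : tailProd n p = 1 := by
  simp [tailProd, Nat.sub_eq_zero_of_le (Nat.succ_le_of_lt hp)]

theorem tailProd_eq_sigma_mul {n p : ℕ} (hp : p ≤ n) :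
    tailProd n p = sigma n p * tailProd n (p + 1) := by
  have h : n + 1 - p = (n + 1 - (p + 1)) + 1 := by omega
  rw [tailProd, h, List.range'_succ, List.map_cons, List.prod_cons, tailProd]

theorem tailProd_self (n : ℕ) : tailProd n n = sigma n n := by
  rw [tailProd_eq_sigma_mul le_rfl, tailProd_of_lt (Nat.lt_succ_self n), mul_one]

theorem commute_sigma_tailProd {n i p : ℕ} (hi : i + 1 < p) :
    Commute (sigma n i) (tailProd n p) := by
  refine Commute.list_prod_right _ _ fun x hx => ?_
  obtain ⟨j, hj, rfl⟩ := List.mem_map.1 hx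
  rw [List.mem_range'_1] at hj
  exact commute_sigma (by omega) (by omega)

theorem sigma_succ_mul_tailProd {n i p : ℕ} (hp : 1 ≤ p) (hpi : p ≤ i) (hi : i + 1 < n) :
    sigma n (i + 1) * tailProd n p = tailProd n p * sigma n i := by
  obtain ⟨k, rfl⟩ := Nat.exists_eq_add_of_le hpi
  induction k generalizing p with
  | zero =>
    have h := (commute_sigma_tailProd (n := n) (i := p) (p := p + 1 + 1) (by omega)).eq
    rw [add_zero, tailProd_eq_sigma_mul (by omega), tailProd_eq_sigma_mul (by omega)]
    calc sigma n (p + 1) * (sigma n p * (sigma n (p + 1) * tailProd n (p + 1 + 1)))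
        = sigma n (p + 1) * sigma n p * sigma n (p + 1) * tailProd n (p + 1 + 1) := by
          simp only [mul_assoc]
      _ = sigma n p * sigma n (p + 1) * (sigma n p * tailProd n (p + 1 + 1)) := by
          rw [← sigma_braid hp hi]; simp only [mul_assoc]
      _ = sigma n p * (sigma n (p + 1) * tailProd n (p + 1 + 1)) * sigma n p := by
          rw [h]; simp only [mul_assoc]
  | succ k ih =>
    have h := ih (p := p + 1) (by omega) (by omega) (by omega)
    rw [show p + 1 + k = p + (k + 1) by omega] at h
    rw [tailProd_eq_sigma_mul (by omega : p ≤ n), ← mul_assoc,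
      ← (commute_sigma (by omega) (by omega)).eq, mul_assoc, h, mul_assoc]

theorem tailProd_mul_self {n i : ℕ} (h1 : 1 ≤ i) (hi : i < n) :
    tailProd n i * tailProd n i = tailProd n (i + 1) * tailProd n i * sigma n (n - 1) := by
  obtain ⟨k, rfl⟩ := Nat.exists_eq_add_of_lt hi
  induction k generalizing i with
  | zero =>
    have h := sigma_braid_last (i + 0 + 1)
    rw [Nat.add_sub_cancel] at h ⊢
    rw [add_zero] at h ⊢
    rw [tailProd_eq_sigma_mul (Nat.le_succ i), tailProd_self]
    simpa only [mul_assoc] using h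
  | succ k ih =>
    have h := ih (i := i + 1) (by omega) (by omega)
    rw [show i + 1 + k + 1 = i + (k + 1) + 1 by omega] at h
    set n := i + (k + 1) + 1
    have hC : sigma n i * tailProd n (i + 1 + 1) = tailProd n (i + 1 + 1) * sigma n i :=
      commute_sigma_tailProd (by omega)
    have e1 : tailProd n i = sigma n i * tailProd n (i + 1) := tailProd_eq_sigma_mul (by omega)
    have e2 : tailProd n (i + 1) = sigma n (i + 1) * tailProd n (i + 1 + 1) :=
      tailProd_eq_sigma_mul (by omega)
    calc tailProd n i * tailProd n i
        = sigma n i * sigma n (i + 1) * (tailProd n (i + 1 + 1) * sigma n i) *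
            tailProd n (i + 1) := by rw [e1, e2]; simp only [mul_assoc]
      _ = sigma n i * sigma n (i + 1) * sigma n i * tailProd n (i + 1 + 1) *
            tailProd n (i + 1) := by rw [← hC]; simp only [mul_assoc]
      _ = sigma n (i + 1) * sigma n i * (tailProd n (i + 1) * tailProd n (i + 1)) := by
          rw [sigma_braid h1 (by omega), e2]; simp only [mul_assoc]
      _ = sigma n (i + 1) * (sigma n i * tailProd n (i + 1 + 1)) * tailProd n (i + 1) *
            sigma n (n - 1) := by rw [h]; simp only [mul_assoc]
      _ = sigma n (i + 1) * tailProd n (i + 1 + 1) * (sigma n i * tailProd n (i + 1)) *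
            sigma n (n - 1) := by rw [hC]; simp only [mul_assoc]
      _ = tailProd n (i + 1) * tailProd n i * sigma n (n - 1) := by rw [← e1, ← e2]

/-! ### Invariant submodules of a quadratic operator -/

section Invariant

variable {K V : Type*} [CommRing K] [AddCommGroup V] [Module K V]

theorem sup_map_mem_invtSubmodule {f : Module.End K V} {c : K} (hf : f * f = c • f + 1)
    (E : Submodule K V) : E ⊔ E.map f ∈ f.invtSubmodule := by
  rw [Module.End.mem_invtSubmodule_iff_map_le, Submodule.map_sup]
  refine sup_le le_sup_right ?_
  rintro _ ⟨_, ⟨x, hx, rfl⟩, rfl⟩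
  have h : f (f x) = c • f x + x := LinearMap.congr_fun hf x
  rw [h]
  exact add_mem (Submodule.smul_mem _ c (Submodule.mem_sup_right (Submodule.mem_map_of_mem hx)))
    (Submodule.mem_sup_left hx)

theorem map_mem_invtSubmodule {f f' g : Module.End K V} (h : f * g = g * f') {E : Submodule K V}
    (hE : E ∈ f'.invtSubmodule) : E.map g ∈ f.invtSubmodule := by
  rw [Module.End.mem_invtSubmodule_iff_forall_mem_of_mem] at hE ⊢
  rintro _ ⟨x, hx, rfl⟩
  exact ⟨f' x, hE x hx, (LinearMap.congr_fun h x).symm⟩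

theorem mem_invtSubmodule_of_le_eigenspace {f : Module.End K V} {a : K} {E : Submodule K V}
    (h : E ≤ f.eigenspace a) : E ∈ f.invtSubmodule := by
  rw [Module.End.mem_invtSubmodule_iff_forall_mem_of_mem]
  intro x hx
  rw [Module.End.mem_eigenspace_iff.1 (h hx)]
  exact E.smul_mem a hx

end Invariant

/-! ### The submodules spanned by the vectors `A_{p_k} ⋯ A_{p_1} m` -/

section OrbitSpan

variable {K V : Type*} [CommRing K] [AddCommGroup V] [Module K V] {n : ℕ}

/-- The span of the vectors `A_{p_k} ⋯ A_{p_1} m` with `1 ≤ p_1 < ⋯ < p_k ≤ p`, where `A_q` is the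
braid `σ_q ⋯ σ_n`. -/
def orbitSpan (π : BraidGroup n →* Module.End K V) (m : V) : ℕ → Submodule K V
  | 0 => Submodule.span K {m}
  | p + 1 => orbitSpan π m p ⊔ (orbitSpan π m p).map (π (tailProd n (p + 1)))

variable {π : BraidGroup n →* Module.End K V} {m : V}

theorem mem_orbitSpan (p : ℕ) : m ∈ orbitSpan π m p := by
  induction p with
  | zero => exact Submodule.mem_span_singleton_self m
  | succ p ih => exact Submodule.mem_sup_left ih

theorem map_orbitSpan {W : Type*} [AddCommGroup W] [Module K W]
    {π' : BraidGroup n →* Module.End K W} {Φ : V →ₗ[K] W} (hΦ : ∀ g, Φ ∘ₗ π g = π' g ∘ₗ Φ)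
    (p : ℕ) : (orbitSpan π m p).map Φ = orbitSpan π' (Φ m) p := by
  induction p with
  | zero => rw [orbitSpan, orbitSpan, Submodule.map_span, Set.image_singleton]
  | succ p ih =>
    rw [orbitSpan, orbitSpan, Submodule.map_sup, ← Submodule.map_comp, hΦ, Submodule.map_comp, ih]

variable {κ : K}

theorem orbitSpan_le_eigenspace (hm : ∀ k, 1 ≤ k → k < n → π (sigma n k) m = κ • m) {p i : ℕ}
    (hp : p < i) (hi : i < n) : orbitSpan π m p ≤ (π (sigma n i)).eigenspace κ := by
  induction p generalizing i with
  | zero =>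
    rw [orbitSpan, Submodule.span_singleton_le_iff_mem, Module.End.mem_eigenspace_iff]
    exact hm i hp hi
  | succ p ih =>
    obtain ⟨i, rfl⟩ : ∃ j, i = j + 1 := ⟨i - 1, by omega⟩
    refine sup_le (ih (by omega) hi) ?_
    rintro _ ⟨x, hx, rfl⟩
    have hxi := Module.End.mem_eigenspace_iff.1 (ih (i := i) (by omega) (by omega) hx)
    rw [Module.End.mem_eigenspace_iff, ← Module.End.mul_apply, ← map_mul,
      sigma_succ_mul_tailProd (by omega) (by omega) hi, map_mul, Module.End.mul_apply, hxi,
      map_smul]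

theorem orbitSpan_mem_invtSubmodule_of_le {i p q : ℕ} (hip : i < p) (hpq : p ≤ q)
    (h : orbitSpan π m p ∈ (π (sigma n i)).invtSubmodule) :
    orbitSpan π m q ∈ (π (sigma n i)).invtSubmodule := by
  induction q, hpq using Nat.le_induction with
  | base => exact h
  | succ q hpq ih =>
    refine Sublattice.sup_mem ih (map_mem_invtSubmodule ?_ ih)
    rw [← map_mul, (commute_sigma_tailProd (by omega)).eq, map_mul]

theorem orbitSpan_one_mem_invtSubmodule
    {c : K} (hq : π (sigma n 0) * π (sigma n 0) = c • π (sigma n 0) + 1) {z : Kˣ}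
    (h0 : π (tailProd n 0) m = z • m) :
    orbitSpan π m 1 ∈ (π (sigma n 0)).invtSubmodule := by
  have hA : π (sigma n 0) (π (tailProd n 1) m) = z • m := by
    rw [← h0, tailProd_eq_sigma_mul n.zero_le, map_mul, Module.End.mul_apply]
  have h : orbitSpan π m 1 = Submodule.span K {π (tailProd n 1) m} ⊔
      (Submodule.span K {π (tailProd n 1) m}).map (π (sigma n 0)) := by
    rw [orbitSpan, orbitSpan, Submodule.map_span, Submodule.map_span, Set.image_singleton,
      Set.image_singleton, hA, Submodule.span_singleton_group_smul_eq, sup_comm]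
  rw [h]
  exact sup_map_mem_invtSubmodule hq _

theorem orbitSpan_succ_mem_invtSubmodule {i : ℕ} (h1 : 1 ≤ i) (hi : i < n)
    {c : K} (hq : π (sigma n i) * π (sigma n i) = c • π (sigma n i) + 1)
    (hm : ∀ k, 1 ≤ k → k < n → π (sigma n k) m = κ • m) :
    orbitSpan π m (i + 1) ∈ (π (sigma n i)).invtSubmodule := by
  obtain ⟨i, rfl⟩ : ∃ j, i = j + 1 := ⟨i - 1, by omega⟩
  set E := orbitSpan π m i
  set A := π (tailProd n (i + 1))
  set A' := π (tailProd n (i + 1 + 1))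
  have hA : A = π (sigma n (i + 1)) * A' := by
    rw [← map_mul, ← tailProd_eq_sigma_mul hi.le]
  have hAA : π (sigma n (i + 1)) * (A' * A) = (A' * A) * π (sigma n (n - 1)) := by
    rw [← mul_assoc, ← hA, ← map_mul, ← map_mul, ← map_mul, tailProd_mul_self h1 hi]
  have hF : orbitSpan π m (i + 1 + 1) =
      E ⊔ (E.map A' ⊔ (E.map A').map (π (sigma n (i + 1)))) ⊔ E.map (A' * A) :=
    calc orbitSpan π m (i + 1 + 1)
        = (E ⊔ E.map A) ⊔ (E ⊔ E.map A).map A' := rfl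
      _ = E ⊔ (E.map A' ⊔ E.map A) ⊔ E.map (A' * A) := by
          rw [Submodule.map_sup, sup_sup_sup_comm, ← sup_assoc, sup_assoc E,
            Module.End.mul_eq_comp, Submodule.map_comp]
      _ = E ⊔ (E.map A' ⊔ (E.map A').map (π (sigma n (i + 1)))) ⊔ E.map (A' * A) := by
          rw [← Submodule.map_comp, ← Module.End.mul_eq_comp, ← hA]
  rw [hF]
  exact Sublattice.sup_mem (Sublattice.sup_mem
    (mem_invtSubmodule_of_le_eigenspace (orbitSpan_le_eigenspace hm i.lt_succ_self hi))
    (sup_map_mem_invtSubmodule hq _))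
    (map_mem_invtSubmodule hAA
      (mem_invtSubmodule_of_le_eigenspace (orbitSpan_le_eigenspace hm (by omega) (by omega))))

theorem orbitSpan_mem_invtSubmodule (hn : 1 ≤ n) {c : Fin (n + 1) → K}
    (hq : ∀ j : Fin (n + 1), π (sigma n j) * π (sigma n j) = c j • π (sigma n j) + 1)
    (hm : ∀ k, 1 ≤ k → k < n → π (sigma n k) m = κ • m) {z : Kˣ}
    (h0 : π (tailProd n 0) m = z • m) (j : Fin (n + 1)) :
    orbitSpan π m n ∈ (π (sigma n j)).invtSubmodule := by
  have hqj := hq j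
  obtain ⟨i, hi⟩ := j
  rcases i.eq_zero_or_pos with rfl | h1
  · exact orbitSpan_mem_invtSubmodule_of_le zero_lt_one hn (orbitSpan_one_mem_invtSubmodule hqj h0)
  rcases (Nat.le_of_lt_succ hi).lt_or_eq with hlt | rfl
  · exact orbitSpan_mem_invtSubmodule_of_le i.lt_succ_self hlt
      (orbitSpan_succ_mem_invtSubmodule h1 hlt hqj hm)
  · obtain ⟨q, rfl⟩ : ∃ q, i = q + 1 := ⟨i - 1, by omega⟩
    rw [orbitSpan, tailProd_self]
    exact sup_map_mem_invtSubmodule hqj _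

theorem finite_orbitSpan (p : ℕ) : Module.Finite K (orbitSpan π m p) := by
  induction p with
  | zero => rw [orbitSpan]; infer_instance
  | succ p ih => exact Submodule.finite_sup _ _

end OrbitSpan

theorem finrank_orbitSpan_le {K V : Type*} [Field K] [AddCommGroup V] [Module K V] {n : ℕ}
    (π : BraidGroup n →* Module.End K V) (m : V) (p : ℕ) :
    Module.finrank K (orbitSpan π m p) ≤ 2 ^ p := by
  induction p with
  | zero => exact (finrank_span_le_card {m}).trans (by simp)
  | succ p ih =>
    have : Module.Finite K (orbitSpan π m p) := finite_orbitSpan p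
    calc Module.finrank K (orbitSpan π m (p + 1))
        ≤ Module.finrank K (orbitSpan π m p) +
            Module.finrank K ((orbitSpan π m p).map (π (tailProd n (p + 1)))) :=
          Submodule.finrank_add_le_finrank_add_finrank _ _
      _ ≤ 2 ^ p + 2 ^ p := add_le_add ih ((Submodule.finrank_map_le _ _).trans ih)
      _ = 2 ^ (p + 1) := by rw [pow_succ, mul_two]

/-! ### Eigenvectors of group representations -/

/-- The pairs `(g, a)` such that `m` is an eigenvector of `g` with eigenvalue `a`. Only for
`m ≠ 0` does `g` determine `a`. -/
def eigenSubgroup {K V G : Type*} [CommRing K] [AddCommGroup V] [Module K V] [Group G]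
    (π : G →* Module.End K V) (m : V) : Subgroup (G × Kˣ) where
  carrier := {x | π x.1 m = x.2 • m}
  one_mem' := by simp
  mul_mem' {x y} hx hy := by
    rw [Set.mem_ofPred_eq] at hx hy ⊢
    rw [Prod.fst_mul, map_mul, Module.End.mul_apply, hy, LinearMap.map_smul_of_tower, hx,
      smul_smul, mul_comm, Prod.snd_mul]
  inv_mem' {x} hx := by
    rw [Set.mem_ofPred_eq] at hx ⊢
    rw [Prod.snd_inv, eq_inv_smul_iff, ← LinearMap.map_smul_of_tower, ← hx, Prod.fst_inv,
      ← Module.End.mul_apply, ← map_mul, inv_mul_cancel, map_one, Module.End.one_apply]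

theorem mem_eigenSubgroup {K V G : Type*} [CommRing K] [AddCommGroup V] [Module K V] [Group G]
    {π : G →* Module.End K V} {m : V} {g : G} {a : Kˣ} :
    (g, a) ∈ eigenSubgroup π m ↔ π g m = a • m := Iff.rfl

theorem list_map_prod_mem {M N : Type*} [Monoid M] [Monoid N] {S : Submonoid (M × N)} {ι : Type*}
    {f : ι → M} {a : N} {l : List ι} (h : ∀ k ∈ l, (f k, a) ∈ S) :
    ((l.map f).prod, a ^ l.length) ∈ S := by
  induction l with
  | nil =>
    rw [List.map_nil, List.prod_nil, List.length_nil, pow_zero]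
    exact S.one_mem
  | cons k l ih =>
    rw [List.forall_mem_cons] at h
    rw [List.map_cons, List.prod_cons, List.length_cons, pow_succ']
    exact S.mul_mem h.1 (ih h.2)

section BraidProducts

variable {n : ℕ} {C : Type*} [CommGroup C] {S : Subgroup (BraidGroup n × C)} {κ : C}

theorem braidG_mem_iff (hσ : ∀ k, 1 ≤ k → k < n → (sigma n k, κ) ∈ S) (i : Fin n) (z : C) :
    (braidG n i, z * κ ^ ((n : ℤ) - 1 - 2 * i)) ∈ S ↔ (tailProd n 0, z) ∈ S := by
  set L := ((List.range i).reverse.map fun k => (sigma n (k + 1))⁻¹).prod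
  set R := ((List.range' (i + 1) (n - 1 - i)).reverse.map fun k => sigma n k).prod
  have hL : (L, κ⁻¹ ^ (i : ℕ)) ∈ S := by
    have h := list_map_prod_mem (S := S.toSubmonoid) (f := fun k => (sigma n (k + 1))⁻¹) (a := κ⁻¹)
      (l := (List.range i).reverse) fun k hk => by
        rw [List.mem_reverse, List.mem_range] at hk
        exact S.inv_mem (hσ (k + 1) (by omega) (by omega))
    rwa [List.length_reverse, List.length_range] at h
  have hR : (R, κ ^ (n - 1 - i : ℕ)) ∈ S := by
    have h := list_map_prod_mem (S := S.toSubmonoid) (f := fun k => sigma n k) (a := κ)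
      (l := (List.range' (i + 1) (n - 1 - i)).reverse) fun k hk => by
        rw [List.mem_reverse, List.mem_range'_1] at hk
        exact hσ k (by omega) (by omega)
    rwa [List.length_reverse, List.length_range'] at h
  have hG : braidG n i = L * tailProd n 0 * R := by
    rw [tailProd, Nat.sub_zero, ← List.range_eq_range']
    rfl
  have hκ : z * κ ^ ((n : ℤ) - 1 - 2 * i) = κ⁻¹ ^ (i : ℕ) * z * κ ^ (n - 1 - i : ℕ) := by
    rw [mul_comm (κ⁻¹ ^ (i : ℕ)), mul_assoc, inv_pow, ← zpow_natCast, ← zpow_natCast, ← zpow_neg,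
      ← zpow_add]
    congr 2
    omega
  rw [hG, hκ, ← Prod.mk_mul_mk, ← Prod.mk_mul_mk, S.mul_mem_cancel_right hR,
    S.mul_mem_cancel_left hL]

theorem braidGPow_mem {γ : Fin n → C} (h : ∀ i, (braidG n i, γ i) ∈ S) (l : Fin n → ℤ) :
    (braidGPow n l, ∏ i, γ i ^ l i) ∈ S := by
  have e : (braidGPow n l, ∏ i, γ i ^ l i) =
      (List.ofFn fun i => (braidG n i, γ i) ^ l i).prod := by
    refine Prod.ext ?_ ?_
    · rw [← MonoidHom.coe_fst, map_list_prod, List.map_ofFn]; rfl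
    · rw [← MonoidHom.coe_snd, map_list_prod, List.map_ofFn, List.prod_ofFn]; rfl
  rw [e]
  refine S.list_prod_mem fun x hx => ?_
  obtain ⟨i, rfl⟩ := List.mem_ofFn.1 hx
  exact S.zpow_mem (h i) (l i)

end BraidProducts

theorem braidGPow_single {n : ℕ} (i : Fin n) : braidGPow n (Pi.single i 1) = braidG n i := by
  rw [braidGPow, List.ofFn_eq_map, List.prod_map_eq_pow_single i,
    List.count_eq_one_of_mem (List.nodup_finRange n) (List.mem_finRange i), pow_one,
    Pi.single_eq_same, zpow_one]
  intro j hj _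
  rw [Pi.single_eq_of_ne hj, zpow_zero]

/-! ### Representations of the affine Hecke algebra -/

section HeckeRep

variable {n : ℕ} {κ₀ κ κₙ : ℂˣ}

theorem T_mul_self (j : Fin (n + 1)) : T n κ₀ κ κₙ j * T n κ₀ κ κₙ j =
    ((heckeParam n κ₀ κ κₙ j : ℂ) - (heckeParam n κ₀ κ κₙ j : ℂ)⁻¹) • T n κ₀ κ κₙ j + 1 := by
  have h : (T n κ₀ κ κₙ j - algebraMap ℂ _ (heckeParam n κ₀ κ κₙ j : ℂ)) *
      (T n κ₀ κ κₙ j + algebraMap ℂ _ ((heckeParam n κ₀ κ κₙ j)⁻¹ : ℂˣ)) = 0 := by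
    have h := RingQuot.mkAlgHom_rel ℂ (HeckeRel.quad (κ₀ := κ₀) (κ := κ) (κₙ := κₙ) j)
    rwa [map_mul, map_sub, map_add, map_zero, AlgHom.commutes, AlgHom.commutes] at h
  have hp := (heckeParam n κ₀ κ κₙ j).ne_zero
  rw [← sub_eq_zero, ← h]
  simp only [Algebra.algebraMap_eq_smul_one, Units.val_inv_eq_inv_val, sub_mul, mul_add,
    mul_smul_comm, smul_mul_assoc, mul_one, one_mul]
  match_scalars <;> field_simp
  ring

theorem braidToHecke_sigma_inv (j : Fin (n + 1)) : braidToHecke n κ₀ κ κₙ (sigma n j)⁻¹ =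
    T n κ₀ κ κₙ j +
      (-((heckeParam n κ₀ κ κₙ j : ℂ) - (heckeParam n κ₀ κ κₙ j : ℂ)⁻¹)) • 1 := by
  refine (left_inv_eq_right_inv (mul_quad_inv _ _ (T_mul_self j)).2 ?_).symm
  rw [T, ← map_mul, mul_inv_cancel, map_one]

theorem sigma_val (j : Fin (n + 1)) : sigma n j = PresentedGroup.of j := by
  rw [sigma, Fin.ofNat_eq_cast, Fin.cast_val_eq_self]

theorem braidToHecke_mem_adjoin (g : BraidGroup n) :
    braidToHecke n κ₀ κ κₙ g ∈ Algebra.adjoin ℂ (Set.range (T n κ₀ κ κₙ)) := by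
  set S := Algebra.adjoin ℂ (Set.range (T n κ₀ κ κₙ))
  have hT : ∀ j, T n κ₀ κ κₙ j ∈ S := fun j => Algebra.subset_adjoin ⟨j, rfl⟩
  have hg : g ∈ Subgroup.closure (Set.range (PresentedGroup.of (rels := {r | BraidRel n r}))) := by
    rw [PresentedGroup.closure_range_of]
    exact Subgroup.mem_top g
  induction hg using Subgroup.closure_induction_left with
  | one =>
    rw [map_one]
    exact S.one_mem
  | mul_left x hx y _ hy =>
    obtain ⟨j, rfl⟩ := hx
    rw [map_mul, ← sigma_val]
    exact S.mul_mem (hT j) hy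
  | inv_mul_cancel x hx y _ hy =>
    obtain ⟨j, rfl⟩ := hx
    rw [map_mul, ← sigma_val, braidToHecke_sigma_inv]
    exact S.mul_mem (S.add_mem (hT j) (S.smul_mem S.one_mem _)) hy

theorem adjoin_range_T : Algebra.adjoin ℂ (Set.range (T n κ₀ κ κₙ)) = ⊤ := by
  rw [eq_top_iff]
  rintro x -
  obtain ⟨y, rfl⟩ := RingQuot.mkAlgHom_surjective ℂ (HeckeRel n κ₀ κ κₙ) x
  induction y using MonoidAlgebra.induction_on with
  | of g => exact braidToHecke_mem_adjoin g
  | add f g hf hg =>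
    rw [map_add]
    exact Subalgebra.add_mem _ hf hg
  | smul r f hf =>
    rw [map_smul]
    exact Subalgebra.smul_mem _ hf r

variable {V : Type*} [AddCommGroup V] [Module ℂ V] {ρ : Hecke n κ₀ κ κₙ →ₐ[ℂ] Module.End ℂ V}

theorem mem_invtSubmodule_of_T {W : Submodule ℂ V}
    (h : ∀ j, W ∈ (ρ (T n κ₀ κ κₙ j)).invtSubmodule) (a : Hecke n κ₀ κ κₙ) :
    W ∈ (ρ a).invtSubmodule := by
  simp only [Module.End.mem_invtSubmodule_iff_forall_mem_of_mem] at h ⊢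
  have ha : a ∈ Algebra.adjoin ℂ (Set.range (T n κ₀ κ κₙ)) := adjoin_range_T ▸ Algebra.mem_top
  induction ha using Algebra.adjoin_induction with
  | mem _ hx =>
    obtain ⟨j, rfl⟩ := hx
    exact h j
  | algebraMap r =>
    intro x hx
    rw [AlgHom.commutes]
    exact W.smul_mem r hx
  | add a b _ _ iha ihb =>
    intro x hx
    rw [map_add]
    exact W.add_mem (iha x hx) (ihb x hx)
  | mul a b _ _ iha ihb =>
    intro x hx
    rw [map_mul]
    exact iha _ (ihb x hx)

/-- The representation of the affine braid group underlying a representation of the affine Hecke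
algebra. -/
def braidAction (ρ : Hecke n κ₀ κ κₙ →ₐ[ℂ] Module.End ℂ V) : BraidGroup n →* Module.End ℂ V :=
  (ρ : Hecke n κ₀ κ κₙ →* Module.End ℂ V).comp (braidToHecke n κ₀ κ κₙ)

theorem braidAction_apply (g : BraidGroup n) : braidAction ρ g = ρ (braidToHecke n κ₀ κ κₙ g) := rfl

theorem orbitSpan_braidAction_eq_top (hn : 1 ≤ n) {m : V} (hcyc : ∀ x, ∃ a, ρ a m = x) {c : ℂ}
    (hm : ∀ k, 1 ≤ k → k < n → braidAction ρ (sigma n k) m = c • m) {z : ℂˣ}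
    (h0 : braidAction ρ (tailProd n 0) m = z • m) : orbitSpan (braidAction ρ) m n = ⊤ := by
  have hq : ∀ j : Fin (n + 1), braidAction ρ (sigma n j) * braidAction ρ (sigma n j) =
      ((heckeParam n κ₀ κ κₙ j : ℂ) - (heckeParam n κ₀ κ κₙ j : ℂ)⁻¹) •
        braidAction ρ (sigma n j) + 1 := fun j => by
    rw [braidAction_apply, ← T, ← map_mul, T_mul_self, map_add, map_smul, map_one]
  have hinv : ∀ a, orbitSpan (braidAction ρ) m n ∈ (ρ a).invtSubmodule :=
    mem_invtSubmodule_of_T fun j => by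
      rw [T, ← braidAction_apply]
      exact orbitSpan_mem_invtSubmodule hn hq hm h0 j
  rw [eq_top_iff]
  rintro x -
  obtain ⟨a, rfl⟩ := hcyc x
  exact hinv a (mem_orbitSpan n)

end HeckeRep

/-! ### Characters and induced modules -/

theorem exists_eigenvalue_of_mem_adjoin {K A V : Type*} [CommRing K] [Semiring A] [Algebra K A]
    [AddCommGroup V] [Module K V] {ρ : A →ₐ[K] Module.End K V} {s : Set A} {v : V}
    (h : ∀ x ∈ s, ∃ c : K, ρ x v = c • v) {b : A} (hb : b ∈ Algebra.adjoin K s) :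
    ∃ c : K, ρ b v = c • v := by
  induction hb using Algebra.adjoin_induction with
  | mem x hx => exact h x hx
  | algebraMap r => exact ⟨r, by rw [AlgHom.commutes, Module.algebraMap_end_apply]⟩
  | add x y _ _ hx hy =>
    obtain ⟨c, hc⟩ := hx
    obtain ⟨d, hd⟩ := hy
    exact ⟨c + d, by rw [map_add, LinearMap.add_apply, hc, hd, add_smul]⟩
  | mul x y _ _ hx hy =>
    obtain ⟨c, hc⟩ := hx
    obtain ⟨d, hd⟩ := hy
    exact ⟨d * c, by rw [map_mul, Module.End.mul_apply, hd, map_smul, hc, mul_smul]⟩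

theorem exists_algHom_of_forall_exists_eigenvalue {K B V : Type*} [CommRing K] [IsDomain K]
    [Semiring B] [Algebra K B] [AddCommGroup V] [Module K V] [Module.IsTorsionFree K V]
    {ρ : B →ₐ[K] Module.End K V} {v : V} (hv : v ≠ 0)
    (h : ∀ b, ∃ c : K, ρ b v = c • v) : ∃ χ : B →ₐ[K] K, ∀ b, ρ b v = χ b • v := by
  choose χ hχ using h
  have eq_of_smul : ∀ {c d : K}, c • v = d • v → c = d := fun e => smul_left_injective K hv e
  refine ⟨AlgHom.ofLinearMap
    { toFun := χ
      map_add' := fun x y => eq_of_smul ?_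
      map_smul' := fun r x => eq_of_smul ?_ } (eq_of_smul ?_) fun x y => eq_of_smul ?_, hχ⟩
  · rw [← hχ, add_smul, ← hχ, ← hχ, map_add, LinearMap.add_apply]
  · rw [← hχ, smul_assoc, ← hχ, map_smul, LinearMap.smul_apply, RingHom.id_apply]
  · rw [one_smul]
    exact (hχ 1).symm.trans (by rw [map_one, Module.End.one_apply])
  · refine (hχ (x * y)).symm.trans ?_
    rw [map_mul, Module.End.mul_apply, hχ, map_smul, hχ, smul_smul, mul_comm]
    rfl

section InducedModule

variable {A : Type*} [Ring A] [Algebra ℂ A] (B : Subalgebra ℂ A) (χ : B →ₐ[ℂ] ℂ)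

/-- The canonical generator `1 ⊗ 1` of the induced module. -/
def inducedVec : Induced B χ := Submodule.Quotient.mk (1 ⊗ₜ[ℂ] 1)

variable {B χ}

theorem inducedRep_mk (a : A) (x : A ⊗[ℂ] ℂ) :
    inducedRep B χ a (Submodule.Quotient.mk x) = Submodule.Quotient.mk (a • x) := rfl

theorem inducedRep_inducedVec (b : B) :
    inducedRep B χ b (inducedVec B χ) = χ b • inducedVec B χ := by
  rw [inducedVec, inducedRep_mk, ← Submodule.Quotient.mk_smul, Submodule.Quotient.eq]
  refine Submodule.subset_span ⟨1, b, 1, ?_⟩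
  rw [TensorProduct.smul_tmul', smul_eq_mul, mul_one, one_mul, mul_one, ← TensorProduct.tmul_smul,
    smul_eq_mul, mul_one]

theorem exists_inducedRep_inducedVec_eq (x : Induced B χ) :
    ∃ a : A, inducedRep B χ a (inducedVec B χ) = x := by
  obtain ⟨y, rfl⟩ := Submodule.Quotient.mk_surjective _ x
  obtain ⟨a, rfl⟩ := (TensorProduct.rid ℂ A).symm.surjective y
  refine ⟨a, ?_⟩
  rw [inducedVec, inducedRep_mk, TensorProduct.smul_tmul', smul_eq_mul, mul_one,
    TensorProduct.rid_symm_apply]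

variable {V : Type*} [AddCommGroup V] [Module ℂ V]

/-- The linear map `a ⊗ z ↦ z • ρ a v`. It factors through the module induced from a character
`χ` when `v` is an eigenvector with character `χ`. -/
def actionMap (ρ : A →ₐ[ℂ] Module.End ℂ V) (v : V) : A ⊗[ℂ] ℂ →ₗ[ℂ] V :=
  LinearMap.applyₗ v ∘ₗ ρ.toLinearMap ∘ₗ (TensorProduct.rid ℂ A).toLinearMap

variable {ρ : A →ₐ[ℂ] Module.End ℂ V} {v : V}

theorem actionMap_tmul (a : A) (z : ℂ) : actionMap ρ v (a ⊗ₜ z) = z • ρ a v := by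
  simp [actionMap]

theorem actionMap_smul (a : A) (x : A ⊗[ℂ] ℂ) : actionMap ρ v (a • x) = ρ a (actionMap ρ v x) := by
  induction x using TensorProduct.induction_on with
  | zero => simp only [smul_zero, map_zero]
  | tmul b z =>
    rw [TensorProduct.smul_tmul', smul_eq_mul, actionMap_tmul, actionMap_tmul, map_mul,
      Module.End.mul_apply, map_smul]
  | add x y hx hy => rw [smul_add, map_add, hx, hy, map_add, map_add]

theorem inducedRel_le_ker_actionMap (hv : ∀ b : B, ρ b v = χ b • v) :
    (inducedRel B χ).restrictScalars ℂ ≤ LinearMap.ker (actionMap ρ v) := by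
  intro x hx
  rw [Submodule.restrictScalars_mem] at hx
  rw [LinearMap.mem_ker]
  induction hx using Submodule.span_induction with
  | mem x hx =>
    obtain ⟨a, b, z, rfl⟩ := hx
    rw [map_sub, actionMap_tmul, actionMap_tmul, map_mul, Module.End.mul_apply, hv, map_smul,
      smul_smul, mul_comm z, sub_self]
  | zero => exact map_zero _
  | add x y _ _ hx hy => rw [map_add, hx, hy, add_zero]
  | smul a x _ hx => rw [actionMap_smul, hx, map_zero]

/-- The intertwiner from the module induced from `χ` to `V` which sends `1 ⊗ 1` to an eigenvector
`v` with character `χ` (Frobenius reciprocity). -/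
def inducedMap (hv : ∀ b : B, ρ b v = χ b • v) : Induced B χ →ₗ[ℂ] V :=
  ((inducedRel B χ).restrictScalars ℂ).liftQ (actionMap ρ v) (inducedRel_le_ker_actionMap hv) ∘ₗ
    (Submodule.Quotient.restrictScalarsEquiv ℂ (inducedRel B χ)).symm.toLinearMap

theorem inducedMap_inducedVec (hv : ∀ b : B, ρ b v = χ b • v) :
    inducedMap hv (inducedVec B χ) = v :=
  (actionMap_tmul 1 1).trans (by rw [map_one, one_smul, Module.End.one_apply])

theorem inducedMap_inducedRep (hv : ∀ b : B, ρ b v = χ b • v) (a : A) (x : Induced B χ) :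
    inducedMap hv (inducedRep B χ a x) = ρ a (inducedMap hv x) := by
  obtain ⟨y, rfl⟩ := Submodule.Quotient.mk_surjective _ x
  exact actionMap_smul a y

end InducedModule

/-! ### The spin representation as a cyclic module -/

section SpinOperators

variable {n : ℕ} {i j : Fin n} {ε : Fin n → Fin 2}

theorem leg_KMat_spinVec (κₙ ψₙ : ℂˣ) (h : ε i = 0) :
    leg i (KMat κₙ ψₙ) (spinVec ε) = ψₙ • spinVec (Function.update ε i 1) := by
  rw [leg_spinVec, h]
  simp [KMat, Units.smul_def]

theorem leg_KBar_spinVec_update (κ₀ ψ₀ : ℂˣ) (h : ε i = 0) :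
    leg i (KBar κ₀ ψ₀) (spinVec (Function.update ε i 1)) = ψ₀ • spinVec ε := by
  have hε : Function.update ε i 0 = ε := by rw [← h, Function.update_eq_self]
  rw [leg_spinVec]
  simp [KBar, hε, Units.smul_def]

theorem leg2_upsilon_flip_spinVec (κ : ℂˣ) (hij : i ≠ j) (hi : ε i = 0) (hj : ε j = 0) :
    leg2 i j (Upsilon κ * flipMat) (spinVec ε) = κ • spinVec ε := by
  have hε : Function.update (Function.update ε i 0) j 0 = ε := by
    rw [← hi, Function.update_eq_self, hi, ← hj, Function.update_eq_self]
  rw [leg2_spinVec hij, hi, hj]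
  simp [upsilon_flip, hε, Units.smul_def]

theorem leg2_upsilon_flip_spinVec_update (κ : ℂˣ) (hij : i ≠ j) (hi : ε i = 0) (hj : ε j = 0) :
    leg2 i j (Upsilon κ * flipMat) (spinVec (Function.update ε j 1)) =
      spinVec (Function.update ε i 1) := by
  have hε : Function.update (Function.update (Function.update ε j 1) i 1) j 0 =
      Function.update ε i 1 := by
    rw [Function.update_comm hij.symm, Function.update_idem, ← hj, Function.update_comm hij,
      Function.update_eq_self]
  rw [leg2_spinVec hij, Function.update_self, Function.update_of_ne hij, hi]
  simp [upsilon_flip, hε]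

end SpinOperators

section SpinRep

variable {n : ℕ} {hn : 2 ≤ n} {κ₀ κ κₙ ψ₀ ψₙ : ℂˣ}

theorem spinBraid_sigma_ofNat (k : ℕ) : spinBraid n hn κ₀ κ κₙ ψ₀ ψₙ (sigma n k) =
    spinGen n hn κ₀ κ κₙ ψ₀ ψₙ (Fin.ofNat (n + 1) k) := by
  simp only [spinBraid, sigma, MonoidHom.comp_apply, PresentedGroup.toGroup.of]
  rfl

theorem spinBraid_sigma_succ {i : ℕ} (hi : i + 1 < n) :
    spinBraid n hn κ₀ κ κₙ ψ₀ ψₙ (sigma n (i + 1)) =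
      leg2 ⟨i, by omega⟩ ⟨i + 1, hi⟩ (Upsilon κ * flipMat) := by
  rw [spinBraid_sigma_ofNat, spinGen_mid _ _ _ _ _ _ _ _ (Nat.succ_pos i) hi]
  rfl

theorem spinBraid_sigma_spinVec_zero {k : ℕ} (h1 : 1 ≤ k) (hk : k < n) :
    spinBraid n hn κ₀ κ κₙ ψ₀ ψₙ (sigma n k) (spinVec 0) = κ • spinVec 0 := by
  obtain ⟨i, rfl⟩ : ∃ i, k = i + 1 := ⟨k - 1, by omega⟩
  rw [spinBraid_sigma_succ hk]
  exact leg2_upsilon_flip_spinVec κ (by simp) rfl rfl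

theorem spinBraid_tailProd_spinVec {p : ℕ} (hp : p < n) {ε : Fin n → Fin 2}
    (h : ∀ k : Fin n, p ≤ k → ε k = 0) :
    spinBraid n hn κ₀ κ κₙ ψ₀ ψₙ (tailProd n (p + 1)) (spinVec ε) =
      ψₙ • spinVec (Function.update ε ⟨p, hp⟩ 1) := by
  obtain ⟨k, hk⟩ := Nat.exists_eq_add_of_lt hp
  induction k generalizing p with
  | zero =>
    obtain rfl : n = p + 1 := hk
    rw [tailProd_self, spinBraid_sigma_ofNat, spinGen_last]
    exact leg_KMat_spinVec κₙ ψₙ (h _ le_rfl)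
  | succ k ih =>
    rw [tailProd_eq_sigma_mul hp, map_mul, Module.End.mul_apply,
      ih (p := p + 1) (by omega) (fun k hk => h k (by omega)) (by omega),
      LinearMap.map_smul_of_tower, spinBraid_sigma_succ (i := p) (by omega),
      leg2_upsilon_flip_spinVec_update κ (by simp) (h _ le_rfl) (h _ (Nat.le_succ p))]

theorem spinBraid_tailProd_zero_spinVec_zero :
    spinBraid n hn κ₀ κ κₙ ψ₀ ψₙ (tailProd n 0) (spinVec 0) = (ψ₀ * ψₙ) • spinVec 0 := by
  rw [tailProd_eq_sigma_mul n.zero_le, map_mul, Module.End.mul_apply,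
    spinBraid_tailProd_spinVec (p := 0) (ε := 0) (by omega) fun _ _ => rfl,
    LinearMap.map_smul_of_tower, spinBraid_sigma_ofNat, spinGen_zero,
    leg_KBar_spinVec_update κ₀ ψ₀ rfl, smul_smul, mul_comm]

theorem spinVec_mem_orbitSpan {p : ℕ} (hp : p ≤ n) {ε : Fin n → Fin 2}
    (h : ∀ k : Fin n, p ≤ k → ε k = 0) :
    spinVec ε ∈ orbitSpan (spinBraid n hn κ₀ κ κₙ ψ₀ ψₙ) (spinVec 0) p := by
  induction p generalizing ε with
  | zero =>
    obtain rfl : ε = 0 := funext fun k => h k (Nat.zero_le k)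
    exact mem_orbitSpan 0
  | succ p ih =>
    set i : Fin n := ⟨p, hp⟩
    have h' : ∀ k : Fin n, p ≤ k → Function.update ε i 0 k = 0 := by
      intro k hk
      rcases eq_or_ne k i with rfl | hki
      · exact Function.update_self ..
      · rw [Function.update_of_ne hki]
        exact h k (Nat.lt_of_le_of_ne hk fun e => hki (Fin.ext e.symm))
    have hmem := ih (by omega) h'
    rcases (by omega : ε i = 0 ∨ ε i = 1) with h0 | h1
    · rw [← h0, Function.update_eq_self] at hmem
      exact Submodule.mem_sup_left hmem
    · have hA := spinBraid_tailProd_spinVec (hn := hn) (κ₀ := κ₀) (κ := κ) (κₙ := κₙ) (ψ₀ := ψ₀)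
        (ψₙ := ψₙ) hp h'
      rw [Function.update_idem, ← h1, Function.update_eq_self] at hA
      refine Submodule.mem_sup_right ((Submodule.smul_mem_iff _ ψₙ.ne_zero).1 ?_)
      exact ⟨_, hmem, hA⟩

/-- The basis of `(ℂ²)^{⊗ n}` consisting of the pure tensors `v_{ε_1} ⊗ ⋯ ⊗ v_{ε_n}`. -/
def spinBasis (n : ℕ) : Module.Basis (Fin n → Fin 2) ℂ (SpinSpace n) :=
  Basis.piTensorProduct fun _ => Pi.basisFun ℂ (Fin 2)

theorem spinBasis_apply (ε : Fin n → Fin 2) : spinBasis n ε = spinVec ε := by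
  simp [spinBasis, spinVec]

theorem finrank_spinSpace (n : ℕ) : Module.finrank ℂ (SpinSpace n) = 2 ^ n := by
  rw [Module.finrank_eq_card_basis (spinBasis n), Fintype.card_fun, Fintype.card_fin,
    Fintype.card_fin]

theorem spinVec_ne_zero (ε : Fin n → Fin 2) : (spinVec ε : SpinSpace n) ≠ 0 := by
  rw [← spinBasis_apply]
  exact (spinBasis n).ne_zero ε

theorem orbitSpan_spinBraid_eq_top :
    orbitSpan (spinBraid n hn κ₀ κ κₙ ψ₀ ψₙ) (spinVec 0) n = ⊤ := by
  rw [eq_top_iff, ← (spinBasis n).span_eq, Submodule.span_le]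
  rintro _ ⟨ε, rfl⟩
  rw [spinBasis_apply]
  exact spinVec_mem_orbitSpan le_rfl fun k hk => absurd k.2 hk.not_gt

theorem braidAction_spinRep :
    braidAction (spinRep n hn κ₀ κ κₙ ψ₀ ψₙ) = spinBraid n hn κ₀ κ κₙ ψ₀ ψₙ := by
  ext g : 1
  rw [braidAction_apply, spinRep, braidToHecke, groupAlg, MonoidHom.comp_apply, MonoidHom.coe_coe,
    RingQuot.liftAlgHom_mkAlgHom_apply, MonoidAlgebra.lift_of]

theorem spinBraid_braidG (i : Fin n) :
    spinBraid n hn κ₀ κ κₙ ψ₀ ψₙ (braidG n i) (spinVec 0) = zeta n κ ψ₀ ψₙ i • spinVec 0 := by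
  have hσ : ∀ k, 1 ≤ k → k < n →
      (sigma n k, κ) ∈ eigenSubgroup (spinBraid n hn κ₀ κ κₙ ψ₀ ψₙ) (spinVec 0) :=
    fun _ h1 hk => mem_eigenSubgroup.2 (spinBraid_sigma_spinVec_zero h1 hk)
  have h0 := mem_eigenSubgroup.2 (spinBraid_tailProd_zero_spinVec_zero (hn := hn) (κ₀ := κ₀)
    (κ := κ) (κₙ := κₙ) (ψ₀ := ψ₀) (ψₙ := ψₙ))
  have h := (braidG_mem_iff hσ i (ψ₀ * ψₙ)).2 h0
  exact mem_eigenSubgroup.1 h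

theorem spinBraid_braidGPow (l : Fin n → ℤ) :
    spinBraid n hn κ₀ κ κₙ ψ₀ ψₙ (braidGPow n l) (spinVec 0) =
      (∏ i, zeta n κ ψ₀ ψₙ i ^ l i) • spinVec 0 := by
  have hY : ∀ i, (braidG n i, zeta n κ ψ₀ ψₙ i) ∈
      eigenSubgroup (spinBraid n hn κ₀ κ κₙ ψ₀ ψₙ) (spinVec 0) :=
    fun i => mem_eigenSubgroup.2 (spinBraid_braidG i)
  exact mem_eigenSubgroup.1 (braidGPow_mem hY l)

end SpinRep

/-! ### The principal series module `M_J(ζ)` -/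

section PrincipalSeries

variable {n : ℕ} {κ₀ κ κₙ : ℂˣ}

theorem zeta_mem_torusSub {ψ₀ ψₙ : ℂˣ} : zeta n κ ψ₀ ψₙ ∈ torusSub n κ₀ κ κₙ (setJ n) := by
  refine ⟨fun i hi h => absurd h hi.ne, fun i _ j hj => ?_⟩
  rw [zeta, zeta, mul_div_mul_left_eq_div, div_eq_mul_inv, ← zpow_sub, ← zpow_natCast, hj]
  congr 1
  push_cast
  ring

theorem heckeParam_succ {i : Fin n} (hi : i ∈ setJ n) : heckeParam n κ₀ κ κₙ i.succ = κ := by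
  rw [heckeParam, if_neg (by simp), if_neg (by rw [Fin.val_succ]; exact hi.ne)]

section Character

variable {I : Set (Fin n)} {γ : Fin n → ℂˣ}

theorem IsPrincipalChar.unique {χ χ' : heckeSub n κ₀ κ κₙ I →ₐ[ℂ] ℂ}
    (h : IsPrincipalChar n κ₀ κ κₙ I γ χ) (h' : IsPrincipalChar n κ₀ κ κₙ I γ χ') : χ = χ' := by
  refine AlgHom.adjoin_ext fun x hx => ?_
  rcases hx with ⟨i, hi, rfl⟩ | ⟨l, rfl⟩
  · exact (h.1 i hi).trans (h'.1 i hi).symm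
  · exact (h.2 l).trans (h'.2 l).symm

theorem exists_isPrincipalChar_of_eigenvector {V : Type*} [AddCommGroup V] [Module ℂ V]
    {ρ : Hecke n κ₀ κ κₙ →ₐ[ℂ] Module.End ℂ V} {v : V} (hv : v ≠ 0)
    (hT : ∀ i ∈ I, ρ (T n κ₀ κ κₙ i.succ) v = heckeParam n κ₀ κ κₙ i.succ • v)
    (hY : ∀ l, ρ (Y n κ₀ κ κₙ l) v = (∏ i, γ i ^ l i) • v) :
    ∃ χ : heckeSub n κ₀ κ κₙ I →ₐ[ℂ] ℂ,
      IsPrincipalChar n κ₀ κ κₙ I γ χ ∧ ∀ b : heckeSub n κ₀ κ κₙ I, ρ b v = χ b • v := by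
  have heig : ∀ b, ∃ c : ℂ, (ρ.comp (heckeSub n κ₀ κ κₙ I).val) b v = c • v := fun b => by
    refine exists_eigenvalue_of_mem_adjoin (ρ := ρ) ?_ b.2
    rintro _ (⟨i, hi, rfl⟩ | ⟨l, rfl⟩)
    exacts [⟨_, hT i hi⟩, ⟨_, hY l⟩]
  obtain ⟨χ, hχ⟩ := exists_algHom_of_forall_exists_eigenvalue hv heig
  exact ⟨χ, ⟨fun i hi => smul_left_injective ℂ hv ((hχ _).symm.trans (hT i hi)),
    fun l => smul_left_injective ℂ hv ((hχ _).symm.trans (hY l))⟩, hχ⟩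

end Character

section Dimension

variable {γ : Fin n → ℂˣ} {χ : heckeSub n κ₀ κ κₙ (setJ n) →ₐ[ℂ] ℂ}

theorem braidAction_principalSeries_sigma (hχ : IsPrincipalChar n κ₀ κ κₙ (setJ n) γ χ) {k : ℕ}
    (h1 : 1 ≤ k) (hk : k < n) :
    braidAction (principalSeries n κ₀ κ κₙ (setJ n) χ) (sigma n k) (inducedVec _ χ) =
      κ • inducedVec _ χ := by
  obtain ⟨i, rfl⟩ : ∃ i, k = i + 1 := ⟨k - 1, by omega⟩
  have hi : (⟨i, by omega⟩ : Fin n) ∈ setJ n := hk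
  have h := inducedRep_inducedVec (χ := χ) ⟨_, T_mem_heckeSub κ₀ κ κₙ hi⟩
  rw [hχ.1 _ hi, heckeParam_succ hi] at h
  exact h

theorem braidAction_principalSeries_braidG (hχ : IsPrincipalChar n κ₀ κ κₙ (setJ n) γ χ)
    (i : Fin n) :
    braidAction (principalSeries n κ₀ κ κₙ (setJ n) χ) (braidG n i) (inducedVec _ χ) =
      γ i • inducedVec _ χ := by
  have hγ : ∏ j, γ j ^ (Pi.single i 1 : Fin n → ℤ) j = γ i := by
    rw [Fintype.prod_eq_single i fun j hj => by rw [Pi.single_eq_of_ne hj, zpow_zero],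
      Pi.single_eq_same, zpow_one]
  have h := inducedRep_inducedVec (χ := χ) ⟨_, Y_mem_heckeSub κ₀ κ κₙ _ (Pi.single i 1)⟩
  rw [hχ.2, hγ] at h
  rw [← braidGPow_single]
  exact h

theorem orbitSpan_principalSeries_eq_top (hn : 1 ≤ n)
    (hχ : IsPrincipalChar n κ₀ κ κₙ (setJ n) γ χ) :
    orbitSpan (braidAction (principalSeries n κ₀ κ κₙ (setJ n) χ)) (inducedVec _ χ) n = ⊤ := by
  set π := braidAction (principalSeries n κ₀ κ κₙ (setJ n) χ)
  set m := inducedVec _ χ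
  have hσ : ∀ k, 1 ≤ k → k < n → (sigma n k, κ) ∈ eigenSubgroup π m := fun _ h1 hk =>
    mem_eigenSubgroup.2 (braidAction_principalSeries_sigma hχ h1 hk)
  have hY : (braidG n ⟨0, hn⟩, γ ⟨0, hn⟩) ∈ eigenSubgroup π m :=
    mem_eigenSubgroup.2 (braidAction_principalSeries_braidG hχ _)
  rw [← inv_mul_cancel_right (γ ⟨0, hn⟩) (κ ^ ((n : ℤ) - 1 - 2 * (0 : ℕ))),
    braidG_mem_iff hσ] at hY
  exact orbitSpan_braidAction_eq_top hn exists_inducedRep_inducedVec_eq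
    (fun _ h1 hk => braidAction_principalSeries_sigma hχ h1 hk) (mem_eigenSubgroup.1 hY)

theorem finite_principalSeries (hn : 1 ≤ n) (hχ : IsPrincipalChar n κ₀ κ κₙ (setJ n) γ χ) :
    Module.Finite ℂ (Induced (heckeSub n κ₀ κ κₙ (setJ n)) χ) := by
  have h := finite_orbitSpan (π := braidAction (principalSeries n κ₀ κ κₙ (setJ n) χ))
    (m := inducedVec _ χ) n
  rw [orbitSpan_principalSeries_eq_top hn hχ] at h
  exact Module.Finite.equiv Submodule.topEquiv

theorem finrank_principalSeries_le (hn : 1 ≤ n) (hχ : IsPrincipalChar n κ₀ κ κₙ (setJ n) γ χ) :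
    Module.finrank ℂ (Induced (heckeSub n κ₀ κ κₙ (setJ n)) χ) ≤ 2 ^ n := by
  have h := finrank_orbitSpan_le (braidAction (principalSeries n κ₀ κ κₙ (setJ n) χ))
    (inducedVec _ χ) n
  rwa [orbitSpan_principalSeries_eq_top hn hχ, finrank_top] at h

end Dimension

variable {ψ₀ ψₙ : ℂˣ}

theorem exists_isPrincipalChar_zeta (hn : 2 ≤ n) : ∃ χ : heckeSub n κ₀ κ κₙ (setJ n) →ₐ[ℂ] ℂ,
    IsPrincipalChar n κ₀ κ κₙ (setJ n) (zeta n κ ψ₀ ψₙ) χ ∧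
    ∀ b : heckeSub n κ₀ κ κₙ (setJ n),
      spinRep n hn κ₀ κ κₙ ψ₀ ψₙ b (spinVec 0) = χ b • spinVec 0 := by
  refine exists_isPrincipalChar_of_eigenvector (spinVec_ne_zero 0) (fun i hi => ?_) fun l => ?_
  · rw [heckeParam_succ hi, T, ← braidAction_apply, braidAction_spinRep]
    exact spinBraid_sigma_spinVec_zero i.val.succ_pos hi
  · rw [Y, ← braidAction_apply, braidAction_spinRep]
    exact spinBraid_braidGPow l

theorem bijective_inducedMap_spinVec {hn : 2 ≤ n} {χ : heckeSub n κ₀ κ κₙ (setJ n) →ₐ[ℂ] ℂ}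
    (hχ : IsPrincipalChar n κ₀ κ κₙ (setJ n) (zeta n κ ψ₀ ψₙ) χ)
    (hv : ∀ b : heckeSub n κ₀ κ κₙ (setJ n),
      spinRep n hn κ₀ κ κₙ ψ₀ ψₙ b (spinVec 0) = χ b • spinVec 0) :
    Function.Bijective (inducedMap hv) := by
  have hsurj : Function.Surjective (inducedMap hv) := by
    have h := map_orbitSpan (Φ := inducedMap hv) (m := inducedVec _ χ)
      (π := braidAction (principalSeries n κ₀ κ κₙ (setJ n) χ))
      (π' := braidAction (spinRep n hn κ₀ κ κₙ ψ₀ ψₙ))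
      (fun g => LinearMap.ext (inducedMap_inducedRep hv _)) n
    rw [inducedMap_inducedVec, braidAction_spinRep, orbitSpan_spinBraid_eq_top] at h
    exact LinearMap.range_eq_top.1 (eq_top_iff.2 (h ▸ LinearMap.map_le_range))
  have := finite_principalSeries (by omega) hχ
  have : Module.Finite ℂ (SpinSpace n) := Module.Finite.of_basis (spinBasis n)
  refine OrzechProperty.bijective_of_surjective_of_finrank_le _ hsurj ?_
  rw [finrank_spinSpace]
  exact finrank_principalSeries_le (by omega) hχ

theorem repIso_principalSeries (hn : 2 ≤ n) {χ : heckeSub n κ₀ κ κₙ (setJ n) →ₐ[ℂ] ℂ}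
    (hχ : IsPrincipalChar n κ₀ κ κₙ (setJ n) (zeta n κ ψ₀ ψₙ) χ) :
    RepIso (spinRep n hn κ₀ κ κₙ ψ₀ ψₙ) (principalSeries n κ₀ κ κₙ (setJ n) χ) := by
  obtain ⟨χ', hχ', hv⟩ := exists_isPrincipalChar_zeta (κ₀ := κ₀) (κ := κ) (κₙ := κₙ) (ψ₀ := ψ₀)
    (ψₙ := ψₙ) hn
  obtain rfl := hχ'.unique hχ
  set e := LinearEquiv.ofBijective (inducedMap hv) (bijective_inducedMap_spinVec hχ hv)
  refine ⟨e.symm, fun a v => ?_⟩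
  rw [LinearEquiv.symm_apply_eq]
  obtain ⟨x, rfl⟩ := e.surjective v
  rw [LinearEquiv.symm_apply_apply]
  exact (inducedMap_inducedRep hv a x).symm

end PrincipalSeries

end

end SpinHecke

/-- The spin representation is isomorphic to the principal series module `M_J(ζ)`; this includes
that `M_J(ζ)` is well defined: `ζ` lies in `T_J` and `H_J` has a unique character `χ_{J,ζ}`. -/
theorem proposition3p3 (n : ℕ) (hn : 2 ≤ n) (κ₀ κ κₙ ψ₀ ψₙ : ℂˣ) :
    SpinHecke.zeta n κ ψ₀ ψₙ ∈ SpinHecke.torusSub n κ₀ κ κₙ (SpinHecke.setJ n) ∧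
    (∃! χ : SpinHecke.heckeSub n κ₀ κ κₙ (SpinHecke.setJ n) →ₐ[ℂ] ℂ,
      SpinHecke.IsPrincipalChar n κ₀ κ κₙ (SpinHecke.setJ n) (SpinHecke.zeta n κ ψ₀ ψₙ) χ) ∧
    ∀ χ : SpinHecke.heckeSub n κ₀ κ κₙ (SpinHecke.setJ n) →ₐ[ℂ] ℂ,
      SpinHecke.IsPrincipalChar n κ₀ κ κₙ (SpinHecke.setJ n) (SpinHecke.zeta n κ ψ₀ ψₙ) χ →
      SpinHecke.RepIso (SpinHecke.spinRep n hn κ₀ κ κₙ ψ₀ ψₙ)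
        (SpinHecke.principalSeries n κ₀ κ κₙ (SpinHecke.setJ n) χ) := by
  refine ⟨SpinHecke.zeta_mem_torusSub, ?_, fun χ hχ => SpinHecke.repIso_principalSeries hn hχ⟩
  obtain ⟨χ, hχ, -⟩ := SpinHecke.exists_isPrincipalChar_zeta hn
  exact ⟨χ, hχ, fun χ' h => h.unique hχ⟩
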